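/- Let $\mathbb{E}$ be a field of characteristic zero and let $X$ be a separated integral scheme of finite type over $\mathbb{E}$, of dimension $l$, with function field $\mathbb{E}(X)$ (for instance an integral hypersurface in $\mathbb{P}^{l+1}_{\mathbb{E}}$). All morphisms are over $\mathbb{E}$. Let $m \ge 0$ be an integer and let $\Omega^m_{X,rat} := (\Omega_{\mathbb{E}(X)|\mathbb{E}}^{\wedge l})^{\otimes m}$ be the space of rational $m$-forms. A *divisorial valuation ring* of $\mathbb{E}(X)$ over $\mathbb{E}$ is a discrete valuation ring $A$ of rank one with $\mathbb{E} \subset A \subset \mathbb{E}(X)$ and with field of fractions $\mathbb{E}(X)$, whose residue field has transcendence degree $l-1$ over $\mathbb{E}$. Let $\widehat{A}$ be its completion at the maximal ideal and $Q(\widehat{A})$ the field of fractions of $\widehat A$. If the rational map $\operatorname{Spec}\widehat{A} \dashrightarrow X$ given by $\mathbb{E}(X) \subset Q(\widehat{A})$ is a morphism $\varphi: \operatorname{Spec}\widehat{A} \to X$, then $\varphi$, up to $X$-isomorphism, is called a *formal prime divisor* on $X$. Its *center* is the image of the closed point. It is *realized* if it is the class of $\operatorname{Spec}\widehat{\mathcal{O}_{X,p}}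 \to X$ for some regular point $p \in X$ of codimension $1$. A form $\eta \in \Omega^m_{X,rat}$ is *regular at $\varphi$* if its image in $Q(\widehat{A}) \otimes_A (\Omega_{A|\mathbb{E}}^{\wedge l})^{\otimes m} = Q(\widehat{A}) \otimes_{\mathbb{E}(X)} \Omega^m_{X,rat}$ comes from $\widehat{A} \otimes_A (\Omega_{A|\mathbb{E}}^{\wedge l})^{\otimes m}$. The *sheaf of $m$-adjoint forms* $\Omega^m_{X,adj}$ is defined by letting $\Gamma(U, \Omega^m_{X,adj})$, for $U \subset X$ open, be the set of all $\eta \in \Omega^m_{X,rat}$ that are regular at all formal prime divisors on $X$ centered in $U$. For a finite set $\mathcal{S}$ of formal prime divisors on $X$, let $\operatorname{supp}(\mathcal{S})$ be the closure of the set of centers of its elements. For a proper birational morphism $\pi: Y \to X$ with $Y$ integral, let $\pi^*\mathcal{S}$ be the set of formal prime divisors $\psi$ on $Y$ such that $\pi\circ\psi$ represents an element of $\mathcal{S}$. The set $\mathcal{S}$ is a *formal desingularization* of $X$ if there is a proper birational morphism $\pi: Y \to X$ with $Y$ integral and regular such that (1) all elements of $\pi^*\mathcal{S}$ are realized on $Y$,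 (2) $\pi^{-1}(\operatorname{supp}(\mathcal{S})) = \operatorname{supp}(\pi^*\mathcal{S})$, and (3) $\pi$ restricts to an isomorphism $Y \setminus \operatorname{supp}(\pi^*\mathcal{S}) \to X \setminus \operatorname{supp}(\mathcal{S})$. **Lemma (Adjointness by Formal Desingularizations).** Let $\mathcal{S}$ be a formal desingularization of $X$, let $U \subset X$ be open and let $\eta \in \Omega^m_{X,rat}$. Then the following are equivalent: 1. $\eta \in \Gamma(U, \Omega^m_{X,adj})$; 2. $\eta \in \Gamma(U \setminus \operatorname{supp}(\mathcal{S}), \Omega^m_{X,adj})$ and $\eta$ is regular at all $\varphi \in \mathcal{S}$ with $\operatorname{center}(\varphi) \in U$. -/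

import Mathlib

open CategoryTheory AlgebraicGeometry
open scoped TensorProduct

universe u

namespace FormalAdjoint

/-! ### Forms: `m`-fold tensor powers of `l`-th exterior powers of Kähler differentials -/

section Forms

variable (E : Type u) [CommRing E]

/-- `(Ω_{B|E}^{∧ l})^{⊗ m}`, with exterior and tensor powers taken over `B`. -/
abbrev Forms (B : Type u) [CommRing B] [Algebra E B] (l m : ℕ) : Type u :=
  ⨂[B]^m (⋀[B]^l (Ω[B⁄E]))

variable (R K : Type u) [CommRing R] [CommRing K] [Algebra E R] [Algebra E K] [Algebra R K]
  [IsScalarTower E R K]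

/-- `(w₁, …, wₗ) ↦ w₁ ∧ ⋯ ∧ wₗ`, from `Ω_{R|E}` to `Ω_{K|E}^{∧ l}`, as an alternating map over `R`. -/
noncomputable def extAlternating (l : ℕ) : (Ω[R⁄E]) [⋀^Fin l]→ₗ[R] ⋀[K]^l (Ω[K⁄E]) :=
  { ((exteriorPower.ιMulti K l (M := Ω[K⁄E])).toMultilinearMap.restrictScalars R).compLinearMap
      (fun _ => KaehlerDifferential.map E E R K) with
    map_eq_zero_of_eq' := fun v i j h hij =>
      (exteriorPower.ιMulti K l (M := Ω[K⁄E])).map_eq_zero_of_eq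
        (fun k => KaehlerDifferential.map E E R K (v k)) (by simp [h]) hij }

/-- The natural map `Ω_{R|E}^{∧ l} → Ω_{K|E}^{∧ l}`. -/
noncomputable def extMap (l : ℕ) : ⋀[R]^l (Ω[R⁄E]) →ₗ[R] ⋀[K]^l (Ω[K⁄E]) :=
  exteriorPower.alternatingMapLinearEquiv (extAlternating E R K l)

/-- The natural map `(Ω_{R|E}^{∧ l})^{⊗ m} → (Ω_{K|E}^{∧ l})^{⊗ m}`. -/
noncomputable def formsMap (l m : ℕ) : Forms E R l m →ₗ[R] Forms E K l m :=
  PiTensorProduct.lift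
    (((PiTensorProduct.tprod K (s := fun _ : Fin m => ⋀[K]^l (Ω[K⁄E]))).restrictScalars
      R).compLinearMap (fun _ => extMap E R K l))

lemma extMap_ιMulti (l : ℕ) (a : Fin l → Ω[R⁄E]) :
    extMap E R K l (exteriorPower.ιMulti R l a) =
      exteriorPower.ιMulti K l (fun i => KaehlerDifferential.map E E R K (a i)) := by
  rw [extMap, exteriorPower.alternatingMapLinearEquiv_apply_ιMulti]
  rfl

lemma formsMap_tprod (l m : ℕ) (w : Fin m → ⋀[R]^l (Ω[R⁄E])) :
    formsMap E R K l m (PiTensorProduct.tprod R w) =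
      PiTensorProduct.tprod K (fun i => extMap E R K l (w i)) := by
  simp [formsMap]

end Forms

/-! ### The completion `Â` of a Noetherian local ring `A` and its ring of fractions `Q(Â)` -/

section Completion

variable (A : Type u) [CommRing A] [IsLocalRing A] [IsNoetherianRing A]

/-- The completion `Â` at the maximal ideal. -/
abbrev Completion : Type u := AdicCompletion (IsLocalRing.maximalIdeal A) A

/-- `Q(Â)`. -/
abbrev CompletionFrac : Type u := FractionRing (Completion A)

lemma isUnit_algebraMap_completionFrac (a : nonZeroDivisors A) :
    IsUnit (((algebraMap (Completion A) (CompletionFrac A)).comp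
      (algebraMap A (Completion A))) a) := by
  rw [RingHom.comp_apply]
  refine IsLocalization.map_units (CompletionFrac A)
    (⟨algebraMap A (Completion A) a, ?_⟩ : nonZeroDivisors (Completion A))
  have h : IsSMulRegular (Completion A) (a : A) :=
    Module.Flat.isSMulRegular_of_nonZeroDivisors a.2
  rw [mem_nonZeroDivisors_iff_right]
  intro x hx
  apply h
  simpa [Algebra.smul_def, mul_comm] using hx

variable (K : Type u) [CommRing K] [Algebra A K] [IsFractionRing A K]

/-- The embedding `Q(A) → Q(Â)` induced by `A → Â`, where `K` is a model of `Q(A)`. -/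
noncomputable def fracToCompletionFrac : K →+* CompletionFrac A :=
  IsLocalization.lift (M := nonZeroDivisors A) (isUnit_algebraMap_completionFrac A)

lemma fracToCompletionFrac_algebraMap (a : A) :
    fracToCompletionFrac A K (algebraMap A K a) = algebraMap A (CompletionFrac A) a := by
  simp [fracToCompletionFrac]
  rfl

/-- `Q(Â)` as an algebra over `K = Q(A)`. -/
noncomputable abbrev completionFracAlgebra : Algebra K (CompletionFrac A) :=
  (fracToCompletionFrac A K).toAlgebra

attribute [local instance] completionFracAlgebra

lemma completionFrac_isScalarTower : IsScalarTower A K (CompletionFrac A) :=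
  IsScalarTower.of_algebraMap_eq fun a => (fracToCompletionFrac_algebraMap A K a).symm

attribute [local instance] completionFrac_isScalarTower

variable (E : Type u) [CommRing E] [Algebra E A] [Algebra E K] [IsScalarTower E A K] (l m : ℕ)

/-- The module of rational forms over `Q(Â)`. Since `Ω_{K|E}` is the localization of `Ω_{A|E}`,
one has `(Ω_{K|E}^{∧ l})^{⊗ m} = K ⊗_A (Ω_{A|E}^{∧ l})^{⊗ m}`, so this is
`Q(Â) ⊗_A (Ω_{A|E}^{∧ l})^{⊗ m}`. -/
abbrev CompletedRatForms : Type u := CompletionFrac A ⊗[K] Forms E K l m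

/-- The pullback `(Ω_{K|E}^{∧ l})^{⊗ m} → Q(Â) ⊗_A (Ω_{A|E}^{∧ l})^{⊗ m}` of rational forms. -/
noncomputable def pullbackForm : Forms E K l m →ₗ[K] CompletedRatForms A K E l m :=
  TensorProduct.mk K (CompletionFrac A) (Forms E K l m) 1

/-- The canonical map from `Â ⊗_A (Ω_{A|E}^{∧ l})^{⊗ m}` to the module of rational forms over
`Q(Â)`, given by `a ⊗ ω ↦ a ⊗ ω`. -/
noncomputable def completedFormsMap :
    Completion A ⊗[A] Forms E A l m →ₗ[A] CompletedRatForms A K E l m :=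
  TensorProduct.lift <| LinearMap.mk₂ A
    (fun a ω => algebraMap (Completion A) (CompletionFrac A) a ⊗ₜ[K] formsMap E A K l m ω)
    (fun a b ω => by simp only [map_add, TensorProduct.add_tmul])
    (fun c a ω => by
      rw [Algebra.smul_def, map_mul, ← IsScalarTower.algebraMap_apply, ← Algebra.smul_def,
        TensorProduct.smul_tmul'])
    (fun a ω ω' => by simp only [map_add, TensorProduct.tmul_add])
    (fun c a ω => by
      rw [map_smul, ← algebraMap_smul K c (formsMap E A K l m ω), ← TensorProduct.smul_tmul,
        algebraMap_smul, TensorProduct.smul_tmul'])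

lemma completedFormsMap_tmul (a : Completion A) (ω : Forms E A l m) :
    completedFormsMap A K E l m (a ⊗ₜ ω) =
      algebraMap (Completion A) (CompletionFrac A) a ⊗ₜ[K] formsMap E A K l m ω := by
  simp [completedFormsMap]

/-- A rational form is regular along `Spec Â` if its pullback comes from
`Â ⊗_A (Ω_{A|E}^{∧ l})^{⊗ m}`. -/
def IsRegularForm (η : Forms E K l m) : Prop :=
  pullbackForm A K E l m η ∈ LinearMap.range (completedFormsMap A K E l m)

end Completion

/-! ### Formal prime divisors -/

section Schemes

variable (E : Type u) [Field E]

/-- The function field of an `E`-scheme is an `E`-algebra. -/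
noncomputable instance functionFieldAlgebra (X : Scheme.{u}) [IrreducibleSpace X]
    [X.Over (Spec (.of E))] : Algebra E X.functionField :=
  ((Scheme.ΓSpecIso (.of E)).inv ≫ (X ↘ Spec (.of E)).appTop ≫
    X.presheaf.germ ⊤ (genericPoint X) trivial).hom.toAlgebra

/-- Rational `m`-forms on an integral `E`-scheme of dimension `l`. -/
abbrev RationalForms (X : Scheme.{u}) [IrreducibleSpace X] [X.Over (Spec (.of E))] (l m : ℕ) :
    Type u :=
  Forms E X.functionField l m

/-- The divisorial valuation rings of `E(X)` over `E`, for `X` of dimension `l`: discrete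
valuation rings of rank one containing `E`, with field of fractions `E(X)`, whose residue field
has transcendence degree `l - 1` over `E`. -/
structure DivisorialValuationRing (X : Scheme.{u}) [IsIntegral X] [X.Over (Spec (.of E))]
    (l : ℕ) where
  ring : Subalgebra E X.functionField
  isDVR : IsDiscreteValuationRing ring
  isFractionRing : IsFractionRing ring X.functionField
  trdeg_residueField :
    Algebra.trdeg E (IsLocalRing.ResidueField ring) + 1 = (l : Cardinal.{u})

attribute [instance] DivisorialValuationRing.isDVR DivisorialValuationRing.isFractionRing

/-- A formal prime divisor: a divisorial valuation ring `A` of `E(X)` over `E` such that the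
rational map `Spec Â ⇢ X`, given at the generic point by `E(X) ⊆ Q(Â)`, is a morphism. As `X` is
separated, the morphism is determined by `A`; and `A` is determined by the class of the morphism
up to `X`-isomorphism. So the elements of this type are the classes, each with the
representative on `Spec Â`. -/
structure FormalPrimeDivisor (X : Scheme.{u}) [IsIntegral X] [X.Over (Spec (.of E))]
    (l : ℕ) extends DivisorialValuationRing E X l where
  hom : Spec (.of (Completion ring)) ⟶ X
  generic : Spec.map (CommRingCat.ofHom
        (algebraMap (Completion ring) (CompletionFrac ring))) ≫ hom =
      Spec.map (CommRingCat.ofHom (fracToCompletionFrac ring X.functionField)) ≫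
        X.fromSpecStalk (genericPoint X)

variable {E} {X : Scheme.{u}} [IsIntegral X] [X.Over (Spec (.of E))] {l : ℕ}

namespace FormalPrimeDivisor

/-- The image of the closed point. -/
noncomputable def center (φ : FormalPrimeDivisor E X l) : X :=
  φ.hom (IsLocalRing.closedPoint (Completion φ.ring))

/-- Regularity of a rational `m`-form at a formal prime divisor. -/
def IsRegularAt (φ : FormalPrimeDivisor E X l) {m : ℕ} (η : RationalForms E X l m) : Prop :=
  IsRegularForm φ.ring X.functionField E l m η

/-- A formal prime divisor is realized if it is the class of `Spec Ô_{X,p} → Spec O_{X,p} → X`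
for a regular point `p` of codimension one. -/
def IsRealized (φ : FormalPrimeDivisor E X l) : Prop :=
  ∃ (p : X) (_ : IsRegularLocalRing (X.presheaf.stalk p)) (_ : Order.coheight p = 1)
    (e : Spec (.of (Completion (X.presheaf.stalk p))) ≅ Spec (.of (Completion φ.ring))),
    e.hom ≫ φ.hom =
      Spec.map (CommRingCat.ofHom
        (algebraMap (X.presheaf.stalk p) (Completion (X.presheaf.stalk p)))) ≫
        X.fromSpecStalk p

/-- For `π : Y ⟶ X`, the formal prime divisor `ψ` on `Y` lifts `φ` on `X`: the classes of `π ∘ ψ`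
and `φ` up to `X`-isomorphism agree. -/
def Lifts {Y : Scheme.{u}} [IsIntegral Y] [Y.Over (Spec (.of E))] (π : Y ⟶ X)
    (ψ : FormalPrimeDivisor E Y l) (φ : FormalPrimeDivisor E X l) : Prop :=
  ∃ e : Spec (.of (Completion ψ.ring)) ≅ Spec (.of (Completion φ.ring)),
    e.hom ≫ φ.hom = ψ.hom ≫ π

end FormalPrimeDivisor

/-- `π^* S`, the set of lifts to `Y` of the formal prime divisors in `S`. -/
def pullbackSet {Y : Scheme.{u}} [IsIntegral Y] [Y.Over (Spec (.of E))] (π : Y ⟶ X)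
    (S : Set (FormalPrimeDivisor E X l)) : Set (FormalPrimeDivisor E Y l) :=
  {ψ | ∃ φ ∈ S, ψ.Lifts π φ}

/-- The closure of the set of all centers. -/
def supp (S : Set (FormalPrimeDivisor E X l)) : Set X :=
  closure (FormalPrimeDivisor.center '' S)

/-- The open complement of `supp S`. -/
def suppCompl (S : Set (FormalPrimeDivisor E X l)) : X.Opens :=
  ⟨(supp S)ᶜ, isClosed_closure.isOpen_compl⟩

/-- The sections over `U` of the sheaf of `m`-adjoint forms. -/
def adjointForms (l m : ℕ) (U : X.Opens) : Set (RationalForms E X l m) :=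
  {η | ∀ φ : FormalPrimeDivisor E X l, φ.center ∈ U → φ.IsRegularAt η}

/-! ### Formal desingularizations -/

/-- A morphism is birational if it restricts to an isomorphism between dense open subschemes. -/
def IsBirational {X Y : Scheme.{u}} (π : Y ⟶ X) : Prop :=
  ∃ f : Scheme.PartialIso Y X, f.iso.hom ≫ f.target.ι = f.source.ι ≫ π

/-- A desingularization: proper, birational, with regular source. -/
structure IsDesingularization {X Y : Scheme.{u}} (π : Y ⟶ X) : Prop where
  proper : IsProper π
  birational : IsBirational π
  regular : ∀ y : Y, IsRegularLocalRing (Y.presheaf.stalk y)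

/-- `S` is a formal description of `π`. The set `π⁻¹(X \ supp S)` is `Y \ supp (π^* S)` by
`preimage_supp`. -/
structure IsFormalDescription {Y : Scheme.{u}} [IsIntegral Y] [Y.Over (Spec (.of E))] (π : Y ⟶ X)
    (S : Set (FormalPrimeDivisor E X l)) : Prop where
  finite : S.Finite
  realized : ∀ ψ ∈ pullbackSet π S, ψ.IsRealized
  preimage_supp : π ⁻¹' supp S = supp (pullbackSet π S)
  isIso : IsIso (π ∣_ suppCompl S)

/-- `S` is a formal desingularization of `X`: it is a formal description of some
desingularization `π : Y ⟶ X` over `E`. -/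
def IsFormalDesingularization (S : Set (FormalPrimeDivisor E X l)) : Prop :=
  ∃ (Y : Scheme.{u}) (_ : IsIntegral Y) (_ : Y.Over (Spec (.of E))) (π : Y ⟶ X)
    (_ : π.IsOver (Spec (.of E))),
    IsDesingularization π ∧ IsFormalDescription π S

end Schemes

end FormalAdjoint

open FormalAdjoint

/-! Restricting the open set gives one direction. For the other, let `π : Y ⟶ X` be the
desingularization and let `φ`, with valuation ring `A`, be centered in `U`. The valuative criterion
gives a point `y` over the center of `φ` with `O_{Y,y} ⊆ A` inside `E(X)`
(`exists_stalkSubalgebra_le`). Hence it is enough that `η` comes from a form over `O_{Y,y}`.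

Since `Y` is regular and the characteristic is zero, `Ω_{O_{Y,y}|E}` is free of rank `l`
(`exists_basis_kaehlerDifferential`), so `η` comes from `O_{Y,y}` exactly when its coefficients in a
basis lie there. A rational function that is regular at the codimension-one generizations `p` of `y`
is regular at `y` (`exists_mul_eq_of_height_one`, by depth at least two of regular local rings of
dimension at least two). This leaves the points `p`, all of which map into `U`.

If `π p` lies in `supp S`, then `p` is a codimension-one point of `supp (π^* S)`. That set is the
closure of codimension-one points and is not all of `Y`, so `p` is one of these points, and
`O_{Y,p}` is the ring of an element of `S` (`exists_of_mem_supp`). Otherwise `O_{Y,p}` is the ring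
of a formal prime divisor on `X` centered in `U \ supp S` (`exists_of_coheight_eq_one`). In both
cases `η` is regular there by assumption. The identity `Q(A) ∩ Â = A`, applied to coefficients,
turns regularity over the completion into regularity over `O_{Y,p}`. -/

namespace FormalAdjoint

/-! ### Transcendence degree and chains of primes -/

section Transcendence

open Cardinal

variable {E : Type u} [Field E]

/-- Lift a transcendence basis of `B'` to an independent family `z` in `B`. If `z` were a
transcendence basis of `B`, then `b` would be algebraic over `E[z]` and so divide a nonzero element
of `E[z]`. Applying `f` would give a relation in `B'`. -/
lemma trdeg_add_one_le_of_surjective {B B' : Type u} [CommRing B] [CommRing B'] [IsDomain B]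
    [IsDomain B'] [Algebra E B] [Algebra E B'] (hB : Algebra.trdeg E B < ℵ₀)
    (f : B →ₐ[E] B') (hf : Function.Surjective f) {b : B} (hb : b ≠ 0) (hfb : f b = 0) :
    Algebra.trdeg E B' + 1 ≤ Algebra.trdeg E B := by
  obtain ⟨ι, y, hy⟩ := exists_isTranscendenceBasis' E B'
  choose z hz using fun i => hf (y i)
  have hzy : f ∘ z = y := funext hz
  have hzi : AlgebraicIndependent E z := .of_comp f (hzy ▸ hy.1)
  rw [← hy.cardinalMk_eq_trdeg]
  have hle : #ι ≤ Algebra.trdeg E B := hzi.cardinalMk_le_trdeg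
  have hne : #ι ≠ Algebra.trdeg E B := by
    intro heq
    have : Finite ι := Cardinal.mk_lt_aleph0_iff.mp (heq ▸ hB)
    have hzB : IsTranscendenceBasis E z := hzi.isTranscendenceBasis_of_trdeg_le_of_finite heq.ge
    have := hzB.isAlgebraic
    obtain ⟨⟨r, hr⟩, hr0, c, hc⟩ := (Algebra.IsAlgebraic.isAlgebraic
      (R := Algebra.adjoin E (Set.range z)) b).exists_nonzero_dvd (mem_nonZeroDivisors_of_ne_zero hb)
    rw [Algebra.adjoin_range_eq_range_aeval] at hr
    obtain ⟨P, hP⟩ := hr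
    refine hr0 (Subtype.ext ?_)
    have h0 : f r = 0 := by
      have : r = b * c := hc
      rw [this, map_mul, hfb, zero_mul]
    have h1 : MvPolynomial.aeval y P = 0 := by
      rw [← h0, ← hP, ← hzy]
      exact (MvPolynomial.comp_aeval_apply z f P).symm
    have h2 : P = 0 := hy.1 (by simpa using h1)
    simp [← hP, h2]
  exact Cardinal.add_one_le_of_lt (lt_of_le_of_ne hle hne)

/-- A strict chain of primes of length `d` drops the transcendence degree by at least `d`. -/
lemma trdeg_quotient_add_le {B : Type u} [CommRing B] [IsDomain B] [Algebra E B]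
    (hB : Algebra.trdeg E B < ℵ₀) (p : LTSeries (PrimeSpectrum B)) (i : ℕ) (hi : i < p.length + 1) :
    Algebra.trdeg E (B ⧸ (p ⟨i, hi⟩).asIdeal) + i ≤ Algebra.trdeg E B := by
  have key (j : Fin (p.length + 1)) : Algebra.trdeg E (B ⧸ (p j).asIdeal) ≤ Algebra.trdeg E B :=
    trdeg_le_of_surjective (Ideal.Quotient.mkₐ E _) (Ideal.Quotient.mkₐ_surjective E _)
  induction i with
  | zero => rw [Nat.cast_zero, add_zero]; exact key _
  | succ i ih =>
    have hlt : p ⟨i, by omega⟩ < p ⟨i + 1, hi⟩ := p.strictMono (by simp [Fin.lt_def])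
    obtain ⟨b, hb, hb'⟩ := Set.exists_of_ssubset (show
      ((p ⟨i, by omega⟩).asIdeal : Set B) ⊂ (p ⟨i + 1, hi⟩).asIdeal from hlt)
    have := trdeg_add_one_le_of_surjective (E := E) ((key _).trans_lt hB)
      (Ideal.Quotient.factorₐ E hlt.le) (Ideal.Quotient.factor_surjective hlt.le)
      (b := Ideal.Quotient.mk _ b) (by rwa [Ne, Ideal.Quotient.eq_zero_iff_mem])
      (by simpa [Ideal.Quotient.eq_zero_iff_mem] using hb)
    refine le_trans ?_ (ih (by omega))
    rw [Nat.cast_succ, add_comm (i : Cardinal), ← add_assoc]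
    gcongr

/-- A chain of primes of length `d` ends in a quotient of transcendence degree at most `n - d`, and
this quotient surjects onto the residue field. -/
lemma trdeg_residueField_add_le {R : Type u} [CommRing R] [IsDomain R] [IsLocalRing R]
    [Algebra E R] {n d : ℕ} (hR : Algebra.trdeg E R = n) (hd : ringKrullDim R = d) :
    ∃ r : ℕ, Algebra.trdeg E (IsLocalRing.ResidueField R) = r ∧ r + d ≤ n := by
  obtain ⟨p, rfl⟩ := Order.le_krullDim_iff.mp hd.ge
  have h1 := trdeg_quotient_add_le (E := E) (hR ▸ natCast_lt_aleph0) p p.length (by omega)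
  have h2 : Algebra.trdeg E (IsLocalRing.ResidueField R) ≤ Algebra.trdeg E (R ⧸ (p ⟨p.length, by omega⟩).asIdeal) :=
    have hle := IsLocalRing.le_maximalIdeal_of_isPrime (p ⟨p.length, by omega⟩).asIdeal
    trdeg_le_of_surjective (Ideal.Quotient.factorₐ E hle) (Ideal.Quotient.factor_surjective hle)
  rw [hR] at h1
  have h3 : Algebra.trdeg E (IsLocalRing.ResidueField R) + p.length ≤ n :=
    le_trans (by gcongr) h1
  obtain ⟨r, hr⟩ := Cardinal.lt_aleph0.mp
    ((le_self_add.trans h3).trans_lt (natCast_lt_aleph0 (n := n)))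
  exact ⟨r, hr, by rw [hr] at h3; exact_mod_cast h3⟩

end Transcendence

/-! ### Differentials of fields in characteristic zero -/

section FieldDifferentials

/-- In characteristic zero, the differentials of a transcendence basis form a basis. -/
lemma finrank_kaehlerDifferential_eq {E K : Type u} [Field E] [CharZero E] [Field K] [Algebra E K]
    {n : ℕ} (hK : Algebra.trdeg E K = n) :
    Module.Finite K (Ω[K⁄E]) ∧ Module.finrank K (Ω[K⁄E]) = n := by
  obtain ⟨ι, x, hx⟩ := exists_isTranscendenceBasis' E K
  have hι : Cardinal.mk ι = n := by rw [hx.cardinalMk_eq_trdeg, hK]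
  have : Finite ι := Cardinal.mk_lt_aleph0_iff.mp (hι ▸ Cardinal.natCast_lt_aleph0)
  let P := MvPolynomial ι E
  let F := FractionRing P
  let : Algebra P K := (MvPolynomial.aeval x).toAlgebra
  have : IsScalarTower E P K := .of_algebraMap_eq fun r => by simp [RingHom.algebraMap_toAlgebra]
  have : FaithfulSMul P K := (faithfulSMul_iff_algebraMap_injective P K).mpr hx.1
  let : Algebra F K := FractionRing.liftAlgebra P K
  have : IsScalarTower P F K := FractionRing.isScalarTower_liftAlgebra P K
  have : CharZero P := charZero_of_injective_algebraMap (algebraMap E P).injective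
  have : CharZero F := charZero_of_injective_algebraMap (IsFractionRing.injective P F)
  have := hx.isAlgebraic
  have : Algebra.IsAlgebraic P K := .of_ringHom_of_comp_eq
    (hx.1.aevalEquiv : P →+* Algebra.adjoin E (Set.range x)) (RingHom.id K)
    hx.1.aevalEquiv.surjective Function.injective_id (RingHom.ext fun p => hx.1.algebraMap_aevalEquiv p)
  have : Algebra.IsAlgebraic F K := IsFractionRing.comap_isAlgebraic_iff (A := P).mp this
  -- Characteristic zero makes `K` separable over `E(x)`. So `E[x] → E(x) → K` is formally étale,
  -- and `Ω_{K|E}` is the base change of `Ω_{E[x]|E}`.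
  have : Algebra.FormallyEtale F K := .of_isSeparable F K
  have : Algebra.FormallyEtale P F := .of_isLocalization (nonZeroDivisors P)
  have : Algebra.FormallyEtale P K := .comp P F K
  let b := ((KaehlerDifferential.mvPolynomialBasis E ι).baseChange K).map
    (KaehlerDifferential.tensorKaehlerEquivOfFormallyEtale E P K)
  refine ⟨.of_basis b, ?_⟩
  rw [Module.finrank_eq_nat_card_basis b]
  exact_mod_cast (Nat.cast_card (α := ι)).trans hι

end FieldDifferentials

/-! ### Differentials of regular local rings -/

section LocalDifferentials

open IsLocalRing

variable {E R : Type u} [Field E] [CommRing R] [Algebra E R]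

/-- Conormal sequence of the residue field: the kernel of `k ⊗ Ω_{R|E} → Ω_{k|E}` is spanned by the
differentials of generators of the maximal ideal. -/
lemma finrank_residueField_tensor_kaehler_le [IsLocalRing R] [IsNoetherianRing R]
    [Module.Finite (ResidueField R) (Ω[ResidueField R⁄E])]
    [Module.Finite R (Ω[R⁄E])] :
    Module.finrank (ResidueField R) (ResidueField R ⊗[R] Ω[R⁄E]) ≤
      (maximalIdeal R).spanFinrank + Module.finrank (ResidueField R) (Ω[ResidueField R⁄E]) := by
  obtain ⟨s, hs, hspan⟩ :=
    Submodule.FG.exists_span_finset_card_eq_spanFinrank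
      (maximalIdeal R).fg_of_isNoetherianRing
  let g := KaehlerDifferential.mapBaseChange E R (ResidueField R)
  let T : Set (ResidueField R ⊗[R] Ω[R⁄E]) := (fun x : R => 1 ⊗ₜ KaehlerDifferential.D E R x) '' s
  have hker : LinearMap.ker g ≤ Submodule.span (ResidueField R) T := by
    intro w hw
    obtain ⟨c, rfl⟩ := (KaehlerDifferential.exact_kerCotangentToTensor_mapBaseChange E R
      (ResidueField R) residue_surjective w).mp hw
    obtain ⟨⟨x, hx⟩, rfl⟩ := Ideal.toCotangent_surjective _ c
    rw [KaehlerDifferential.kerCotangentToTensor_toCotangent]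
    change (1 : ResidueField R) ⊗ₜ[R] KaehlerDifferential.D E R x ∈ _
    have hx' : x ∈ Submodule.span R (s : Set R) := by
      rw [hspan]
      rwa [← ker_residue]
    have hsub : ∀ y ∈ (s : Set R), residue R y = 0 := fun y hy => by
      rw [residue_eq_zero_iff, ← hspan]
      exact Submodule.subset_span hy
    clear hw hx
    -- The vanishing residue is carried through the induction: in `d(ra) = r da + a dr` the last
    -- term dies in `k ⊗ Ω` only because `a` lies in the maximal ideal.
    suffices residue R x = 0 ∧
      (1 : ResidueField R) ⊗ₜ[R] KaehlerDifferential.D E R x ∈ Submodule.span (ResidueField R) T from this.2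
    induction hx' using Submodule.span_induction with
    | mem y hy => exact ⟨hsub y hy, Submodule.subset_span ⟨y, hy, rfl⟩⟩
    | zero => simp
    | add a b _ _ ha hb =>
      refine ⟨by simp [ha.1, hb.1], ?_⟩
      rw [map_add, TensorProduct.tmul_add]
      exact add_mem ha.2 hb.2
    | smul r a _ ha =>
      refine ⟨by simp [ha.1], ?_⟩
      have : (1 : ResidueField R) ⊗ₜ[R] KaehlerDifferential.D E R (r • a) =
          residue R r • (1 : ResidueField R) ⊗ₜ[R] KaehlerDifferential.D E R a := by
        rw [smul_eq_mul, Derivation.leibniz, TensorProduct.tmul_add, TensorProduct.tmul_smul,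
          TensorProduct.tmul_smul, TensorProduct.smul_tmul', TensorProduct.smul_tmul',
          TensorProduct.smul_tmul', Algebra.smul_def a, ResidueField.algebraMap_eq, ha.1]
        simp [Algebra.smul_def]
      rw [this]
      exact Submodule.smul_mem _ _ ha.2
  have h1 : Module.finrank (ResidueField R) (LinearMap.ker g) ≤ s.card := by
    refine (Submodule.finrank_mono hker).trans ?_
    classical
    rw [show T = ((s.image fun x : R => (1 : ResidueField R) ⊗ₜ[R] KaehlerDifferential.D E R x :
      Finset _) : Set _) by simp [T]]
    exact (finrank_span_finset_le_card _).trans Finset.card_image_le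
  have h2 := LinearMap.finrank_range_add_finrank_ker g
  have h3 : Module.finrank (ResidueField R) (LinearMap.range g) ≤ _ := Submodule.finrank_le _
  rw [← hs]
  omega

variable {K : Type u} [Field K] [Algebra R K] [IsFractionRing R K] [Algebra E K]
  [IsScalarTower E R K]

lemma trdeg_eq_of_isFractionRing {E R K : Type u} [Field E] [CommRing R] [IsDomain R]
    [Algebra E R] [Field K] [Algebra R K] [IsFractionRing R K] [Algebra E K]
    [IsScalarTower E R K] : Algebra.trdeg E R = Algebra.trdeg E K := by
  have := IsFractionRing.injective R K
  have : FaithfulSMul R K := (faithfulSMul_iff_algebraMap_injective R K).mpr this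
  have : Algebra.IsAlgebraic R K := (IsFractionRing.comap_isAlgebraic_iff (K := K)).mpr inferInstance
  rw [← trdeg_add_eq E R (A := K), trdeg_eq_zero (R := R), add_zero]

section

variable [CharZero E] [IsDomain R] [IsRegularLocalRing R] [Algebra.EssFiniteType E R]

variable (K) in
-- Regularity makes the number of generators of the maximal ideal equal to the dimension. The chain
-- bound and the conormal bound then squeeze the rank of `k ⊗ Ω_{R|E}` below `n`.
lemma finrank_residueField_kaehler_bounds {n : ℕ} (hK : Algebra.trdeg E K = n) :
    ∃ r : ℕ, Algebra.trdeg E (ResidueField R) = r ∧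
      (r + (maximalIdeal R).spanFinrank ≤ n) ∧
      Module.finrank (ResidueField R) (ResidueField R ⊗[R] Ω[R⁄E]) ≤
        r + (maximalIdeal R).spanFinrank := by
  obtain ⟨r, hr, hrn⟩ := trdeg_residueField_add_le (E := E) (R := R) (n := n)
    (by rw [← hK, trdeg_eq_of_isFractionRing (K := K)])
    (d := (maximalIdeal R).spanFinrank) IsRegularLocalRing.spanFinrank_maximalIdeal.symm
  obtain ⟨hfin, hrank⟩ := finrank_kaehlerDifferential_eq hr
  refine ⟨r, hr, hrn, ?_⟩
  have := finrank_residueField_tensor_kaehler_le (E := E) (R := R)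
  omega

/-- The differentials of a regular local ring essentially of finite type over a field of
characteristic zero are free, compatibly with those of the field of fractions. -/
lemma exists_basis_kaehlerDifferential {n : ℕ} (hK : Algebra.trdeg E K = n) :
    ∃ (b : Module.Basis (Fin n) R (Ω[R⁄E])) (b' : Module.Basis (Fin n) K (Ω[K⁄E])),
      ∀ i, KaehlerDifferential.map E E R K (b i) = b' i := by
  obtain ⟨r, hr, hrn, hle⟩ := finrank_residueField_kaehler_bounds (R := R) K hK
  obtain ⟨hfin, hrank⟩ := finrank_kaehlerDifferential_eq hK
  have htop : (⊤ : Submodule R (Ω[R⁄E])).FG := Module.Finite.fg_top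
  obtain ⟨s, hs, hspan⟩ := htop.exists_span_finset_card_eq_spanFinrank
  -- By Nakayama a minimal generating set of `Ω_{R|E}` has at most `n` elements. Its image spans the
  -- `n`-dimensional space `Ω_{K|E}`, so it has exactly `n`, and they are independent.
  have hcard : s.card ≤ n := by
    rw [hs, ← TensorProduct.spanFinrank_top_eq_of_residueField _ htop,
      ← Module.finrank_eq_spanFinrank_of_free,
      LinearEquiv.finrank_eq (LinearEquiv.baseChange R (ResidueField R) _ _ Submodule.topEquiv)]
    omega
  have hspanK := span_eq_top_of_isLocalizedModule K (nonZeroDivisors R)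
    (KaehlerDifferential.map E E R K) hspan
  have hcard' : n ≤ s.card := by
    classical
    rw [← Finset.coe_image] at hspanK
    rw [← hrank, ← finrank_top, ← hspanK]
    exact (finrank_span_finset_le_card _).trans Finset.card_image_le
  let e : Fin n ≃ s := (Finset.equivFinOfCardEq (le_antisymm hcard hcard')).symm
  let v : Fin n → Ω[R⁄E] := fun i => e i
  have hv : Set.range v = s := by
    rw [show v = Subtype.val ∘ e from rfl, e.surjective.range_comp, Subtype.range_val]
  let v' : Fin n → Ω[K⁄E] := fun i => KaehlerDifferential.map E E R K (v i)
  have hv' : ⊤ ≤ Submodule.span K (Set.range v') := by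
    rw [show v' = KaehlerDifferential.map E E R K ∘ v from rfl, Set.range_comp, hv, hspanK]
  have hli : LinearIndependent K v' :=
    linearIndependent_of_top_le_span_of_card_eq_finrank hv' (by simp [hrank])
  have hli' : LinearIndependent R v := .of_comp (KaehlerDifferential.map E E R K)
    (hli.restrict_scalars (by
      simpa [Algebra.smul_def] using IsFractionRing.injective R K))
  exact ⟨.mk hli' (by rw [hv, hspan]), .mk hli hv', fun i => by simp [v']⟩

variable (K) in
-- Freeness of `Ω_{R|E}` gives `k ⊗ Ω_{R|E}` dimension exactly `n`, which forces equality in the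
-- bounds above. This is the condition that makes a codimension-one local ring divisorial.
lemma trdeg_residueField_add_one {n : ℕ} (hK : Algebra.trdeg E K = n) (hR : ringKrullDim R = 1) :
    Algebra.trdeg E (ResidueField R) + 1 = n := by
  obtain ⟨r, hr, hrn, hle⟩ := finrank_residueField_kaehler_bounds (R := R) K hK
  obtain ⟨b, -⟩ := exists_basis_kaehlerDifferential (R := R) (K := K) hK
  have h1 : (maximalIdeal R).spanFinrank = 1 := by
    have := IsRegularLocalRing.spanFinrank_maximalIdeal (R := R)
    rw [hR] at this
    exact_mod_cast this
  rw [Module.finrank_eq_card_basis (b.baseChange (ResidueField R)), Fintype.card_fin, h1] at hle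
  rw [h1] at hrn
  rw [hr]
  exact_mod_cast le_antisymm hrn hle

end

end LocalDifferentials

/-! ### Forms in coordinates -/

section FormsBasis

variable {E : Type u} [CommRing E]

/-- The basis of `(Ω_{B|E}^{∧ l})^{⊗ m}` induced by a basis of `Ω_{B|E}`. -/
noncomputable def formsBasis {B : Type u} [CommRing B] [Algebra E B] {n : ℕ}
    (b : Module.Basis (Fin n) B (Ω[B⁄E])) (l m : ℕ) :
    Module.Basis (Fin m → Set.powersetCard (Fin n) l) B (Forms E B l m) :=
  Basis.piTensorProduct fun _ => b.exteriorPower l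

variable {R K : Type u} [CommRing R] [CommRing K] [Algebra E R] [Algebra E K] [Algebra R K]
  [IsScalarTower E R K] {n : ℕ}

lemma formsMap_formsBasis (b : Module.Basis (Fin n) R (Ω[R⁄E]))
    (b' : Module.Basis (Fin n) K (Ω[K⁄E]))
    (h : ∀ i, KaehlerDifferential.map E E R K (b i) = b' i) (l m : ℕ)
    (i : Fin m → Set.powersetCard (Fin n) l) :
    formsMap E R K l m (formsBasis b l m i) = formsBasis b' l m i := by
  simp only [formsBasis, Basis.piTensorProduct_apply, formsMap_tprod, exteriorPower.basis_apply,
    exteriorPower.ιMulti_family, extMap_ιMulti]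
  simp [Function.comp_def, h]

lemma formsMap_sum_formsBasis (b : Module.Basis (Fin n) R (Ω[R⁄E]))
    (b' : Module.Basis (Fin n) K (Ω[K⁄E]))
    (h : ∀ i, KaehlerDifferential.map E E R K (b i) = b' i) {l m : ℕ}
    (c : (Fin m → Set.powersetCard (Fin n) l) → R) :
    formsMap E R K l m (∑ i, c i • formsBasis b l m i) =
      ∑ i, algebraMap R K (c i) • formsBasis b' l m i := by
  simp [map_sum, formsMap_formsBasis b b' h]

lemma formsBasis_repr_formsMap (b : Module.Basis (Fin n) R (Ω[R⁄E]))
    (b' : Module.Basis (Fin n) K (Ω[K⁄E]))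
    (h : ∀ i, KaehlerDifferential.map E E R K (b i) = b' i) {l m : ℕ} (ω : Forms E R l m)
    (i : Fin m → Set.powersetCard (Fin n) l) :
    (formsBasis b' l m).repr (formsMap E R K l m ω) i =
      algebraMap R K ((formsBasis b l m).repr ω i) := by
  conv_lhs => rw [← (formsBasis b l m).sum_repr ω]
  rw [formsMap_sum_formsBasis b b' h, Module.Basis.repr_sum_self]

/-- This reduces questions about forms to questions about their coefficients, which are rational
functions. -/
lemma mem_range_formsMap_iff (b : Module.Basis (Fin n) R (Ω[R⁄E]))
    (b' : Module.Basis (Fin n) K (Ω[K⁄E]))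
    (h : ∀ i, KaehlerDifferential.map E E R K (b i) = b' i) {l m : ℕ} (η : Forms E K l m) :
    η ∈ LinearMap.range (formsMap E R K l m) ↔
      ∀ i, (formsBasis b' l m).repr η i ∈ Set.range (algebraMap R K) := by
  constructor
  · rintro ⟨ω, rfl⟩ i
    exact ⟨_, (formsBasis_repr_formsMap b b' h ω i).symm⟩
  · intro hη
    choose c hc using hη
    refine ⟨∑ i, c i • formsBasis b l m i, ?_⟩
    rw [formsMap_sum_formsBasis b b' h]
    simp_rw [hc, Module.Basis.sum_repr]

lemma kaehlerDifferential_map_map (R' : Type u) [CommRing R'] [Algebra E R'] [Algebra R' K]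
    [IsScalarTower E R' K] [Algebra R R'] [IsScalarTower R R' K] [IsScalarTower E R R']
    (w : Ω[R⁄E]) :
    KaehlerDifferential.map E E R' K (KaehlerDifferential.map E E R R' w) =
      KaehlerDifferential.map E E R K w := by
  have hw : w ∈ Submodule.span R (Set.range (KaehlerDifferential.D E R)) := by
    simp [KaehlerDifferential.span_range_derivation]
  induction hw using Submodule.span_induction with
  | mem _ h =>
    obtain ⟨a, rfl⟩ := h
    simp [← IsScalarTower.algebraMap_apply]
  | zero => simp
  | add x y _ _ hx hy => simp [hx, hy]
  | smul r x _ hx =>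
    rw [map_smul, ← algebraMap_smul R' r (KaehlerDifferential.map E E R R' x), map_smul,
      algebraMap_smul, hx, map_smul]

/-- Functoriality: the map of forms along `R → K` factors through `R'`. -/
lemma range_formsMap_mono (R' : Type u) [CommRing R'] [Algebra E R'] [Algebra R' K]
    [IsScalarTower E R' K] [Algebra R R'] [IsScalarTower R R' K] [IsScalarTower E R R'] (l m : ℕ) :
    Set.range (formsMap E R K l m) ⊆ Set.range (formsMap E R' K l m) := by
  have hext : ∀ w, extMap E R' K l (extMap E R R' l w) = extMap E R K l w := by
    intro w
    suffices (extMap E R' K l).restrictScalars R ∘ₗ extMap E R R' l = extMap E R K l from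
      LinearMap.congr_fun this w
    ext v
    simp [extMap_ιMulti, kaehlerDifferential_map_map]
  have hforms : ∀ w, formsMap E R' K l m (formsMap E R R' l m w) = formsMap E R K l m w := by
    intro w
    suffices (formsMap E R' K l m).restrictScalars R ∘ₗ formsMap E R R' l m = formsMap E R K l m from
      LinearMap.congr_fun this w
    ext v
    simp [formsMap_tprod, hext]
  rintro _ ⟨w, rfl⟩
  exact ⟨_, hforms w⟩

end FormsBasis

/-! ### Descent from the completion -/

section Completion

attribute [local instance] completionFracAlgebra completionFrac_isScalarTower

variable {A K : Type u} [CommRing A] [IsLocalRing A] [IsNoetherianRing A] [Field K] [Algebra A K]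
  [IsFractionRing A K]

/-- `Q(A) ∩ Â = A`. -/
lemma mem_range_algebraMap_of_mem_completion {f : K}
    (hf : fracToCompletionFrac A K f ∈
      Set.range (algebraMap (Completion A) (CompletionFrac A))) :
    f ∈ Set.range (algebraMap A K) := by
  obtain ⟨c, hc⟩ := hf
  obtain ⟨a, ⟨b, hb⟩, rfl⟩ := IsLocalization.exists_mk'_eq (nonZeroDivisors A) f
  have h1 : c * algebraMap A _ b = algebraMap A _ a := by
    apply IsFractionRing.injective (Completion A) (CompletionFrac A)
    rw [map_mul, hc, ← IsScalarTower.algebraMap_apply, ← IsScalarTower.algebraMap_apply,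
      ← fracToCompletionFrac_algebraMap A K, ← map_mul, IsLocalization.mk'_spec K a ⟨b, hb⟩,
      fracToCompletionFrac_algebraMap]
  -- From `cb = a` in `Â`, reduction modulo each power of the maximal ideal gives `a ∈ bA + 𝔪^i` for
  -- all `i`. Krull's intersection theorem in `A/bA` then gives `a ∈ bA`.
  have h2 : a ∈ Ideal.span {b} := by
    rw [← Ideal.Quotient.eq_zero_iff_mem]
    have := Ideal.iInf_pow_smul_eq_bot_of_isLocalRing (M := A ⧸ Ideal.span {b})
      (IsLocalRing.maximalIdeal A) Ideal.IsPrime.ne_top'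
    rw [← Submodule.mem_bot A, ← this, Submodule.mem_iInf]
    intro i
    obtain ⟨d, hd⟩ := Ideal.Quotient.mk_surjective
      (AdicCompletion.evalₐ (IsLocalRing.maximalIdeal A) i c)
    have h3 := congr(AdicCompletion.evalₐ (IsLocalRing.maximalIdeal A) i $h1)
    rw [map_mul, AlgHom.commutes, AlgHom.commutes, ← hd] at h3
    change Ideal.Quotient.mk _ d * Ideal.Quotient.mk _ b = Ideal.Quotient.mk _ a at h3
    rw [← map_mul, eq_comm, Ideal.Quotient.mk_eq_mk_iff_sub_mem] at h3
    have h4 : Ideal.Quotient.mk (Ideal.span {b}) a = (a - d * b) • 1 := by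
      rw [Algebra.smul_def, mul_one, Ideal.Quotient.algebraMap_eq, eq_comm,
        Ideal.Quotient.mk_eq_mk_iff_sub_mem]
      simpa using Ideal.mul_mem_left _ _ (Ideal.mem_span_singleton_self b)
    rw [h4]
    exact Submodule.smul_mem_smul h3 trivial
  obtain ⟨d, rfl⟩ := Ideal.mem_span_singleton'.mp h2
  exact ⟨d, by rw [eq_comm, IsLocalization.mk'_eq_iff_eq_mul, map_mul]⟩

variable {E : Type u} [CommRing E] [Algebra E A] [Algebra E K] [IsScalarTower E A K] {l m : ℕ}

lemma isRegularForm_of_mem_range {η : Forms E K l m}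
    (h : η ∈ Set.range (formsMap E A K l m)) : IsRegularForm A K E l m η := by
  obtain ⟨ω, rfl⟩ := h
  exact ⟨1 ⊗ₜ ω, by simp [completedFormsMap_tmul, pullbackForm]⟩

/-- The compatible bases remain bases after base change to `Â` and `Q(Â)`, so the coefficients of
`η` lie in `Q(A) ∩ Â = A`. -/
lemma mem_range_of_isRegularForm {n : ℕ} (b : Module.Basis (Fin n) A (Ω[A⁄E]))
    (b' : Module.Basis (Fin n) K (Ω[K⁄E]))
    (h : ∀ i, KaehlerDifferential.map E E A K (b i) = b' i) {η : Forms E K l m}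
    (hη : IsRegularForm A K E l m η) : η ∈ Set.range (formsMap E A K l m) := by
  obtain ⟨t, ht⟩ := hη
  refine (mem_range_formsMap_iff b b' h η).mpr fun i =>
    mem_range_algebraMap_of_mem_completion ⟨((formsBasis b l m).baseChange _).repr t i, ?_⟩
  have key (t : Completion A ⊗[A] Forms E A l m) :
      algebraMap (Completion A) (CompletionFrac A) (((formsBasis b l m).baseChange _).repr t i) =
        ((formsBasis b' l m).baseChange (CompletionFrac A)).repr
          (completedFormsMap A K E l m t) i := by
    induction t using TensorProduct.induction_on with
    | zero => simp
    | add x y hx hy => simp [hx, hy]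
    | tmul a ω =>
      rw [completedFormsMap_tmul, Module.Basis.baseChange_repr_tmul,
        Module.Basis.baseChange_repr_tmul]
      rw [formsBasis_repr_formsMap b b' h, algebraMap_smul, Algebra.smul_def, map_mul, Algebra.smul_def,
        ← IsScalarTower.algebraMap_apply]
  rw [key, ht, pullbackForm, TensorProduct.mk_apply, Module.Basis.baseChange_repr_tmul,
    Algebra.smul_def, mul_one]
  rfl

end Completion

/-! ### Regular local rings: integrality and depth -/

section RegularLocal

open IsLocalRing

/-- The class of `x` in the cotangent space is nonzero, hence extends to a basis. By Nakayama, lifts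
of the basis generate. -/
lemma exists_span_insert_eq_maximalIdeal {R : Type u} [CommRing R] [IsLocalRing R]
    [IsNoetherianRing R] {x : R} (hx : x ∈ maximalIdeal R) (hx2 : x ∉ maximalIdeal R ^ 2) :
    ∃ t : Finset R, t.card + 1 ≤ (maximalIdeal R).spanFinrank ∧
      Ideal.span (insert x (t : Set R)) = maximalIdeal R := by
  classical
  let V := CotangentSpace R
  let x' : V := (maximalIdeal R).toCotangent ⟨x, hx⟩
  have hx' : x' ≠ 0 := by
    rwa [Ne, Ideal.toCotangent_eq_zero]
  let W : Submodule (ResidueField R) V := Submodule.span _ {x'}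
  let c := Module.finBasis (ResidueField R) (V ⧸ W)
  choose v hv using fun i => W.mkQ_surjective (c i)
  choose t ht using fun i => (maximalIdeal R).toCotangent_surjective (v i)
  have hW := W.finrank_quotient_add_finrank
  rw [finrank_span_singleton hx', ← spanFinrank_maximalIdeal_eq_finrank_cotangentSpace] at hW
  refine ⟨Finset.univ.image fun i => (t i : R), ?_, ?_⟩
  · refine le_trans (Nat.add_le_add_right Finset.card_image_le _) ?_
    simpa using hW.le
  have hV : Submodule.span (ResidueField R)
      ((maximalIdeal R).toCotangent '' (insert ⟨x, hx⟩ (Set.range t))) = ⊤ := by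
    rw [Set.image_insert_eq, ← Set.range_comp, Submodule.span_insert]
    have : (maximalIdeal R).toCotangent ∘ t = v := funext ht
    rw [this]
    rw [← Submodule.map_mkQ_eq_top, Submodule.map_span, ← Set.range_comp,
      show W.mkQ ∘ v = c from funext hv, c.span_eq]
  have := congr(Submodule.map (maximalIdeal R).subtype $(CotangentSpace.span_image_eq_top_iff.mp hV))
  rw [Submodule.map_span, Submodule.map_top, Submodule.range_subtype, Set.image_insert_eq,
    ← Set.range_comp] at this
  simpa [Function.comp_def] using! this

variable {R : Type u} [CommRing R] [IsRegularLocalRing R]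

/-- Dividing by `x` removes one generator of the maximal ideal and lowers the dimension by at most
one. -/
lemma isRegularLocalRing_quotient {x : R} (hx : x ∈ maximalIdeal R)
    (hx2 : x ∉ maximalIdeal R ^ 2) :
    ∃ _ : IsRegularLocalRing (R ⧸ Ideal.span {x}),
      (maximalIdeal (R ⧸ Ideal.span {x})).spanFinrank < (maximalIdeal R).spanFinrank := by
  classical
  obtain ⟨t, ht, htm⟩ := exists_span_insert_eq_maximalIdeal hx hx2
  have hle : Ideal.span {x} ≤ maximalIdeal R := by simpa [Ideal.span_le] using hx
  have : Nontrivial (R ⧸ Ideal.span {x}) :=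
    Ideal.Quotient.nontrivial_iff.mpr fun h => Ideal.IsPrime.ne_top' (top_le_iff.mp (h ▸ hle))
  have := IsLocalRing.of_surjective' (Ideal.Quotient.mk (Ideal.span {x}))
    Ideal.Quotient.mk_surjective
  have hm : maximalIdeal (R ⧸ Ideal.span {x}) =
      Ideal.span (t.image (Ideal.Quotient.mk (Ideal.span {x})) : Finset _) := by
    rw [← map_maximalIdeal_of_surjective _ (Ideal.Quotient.mk_surjective (I := Ideal.span {x})),
      ← htm, Ideal.map_span, Set.image_insert_eq, Ideal.Quotient.mk_singleton_self,
      Ideal.span_insert_zero, Finset.coe_image]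
  have hcard : (maximalIdeal (R ⧸ Ideal.span {x})).spanFinrank ≤ t.card := by
    rw [hm]
    refine (Submodule.spanFinrank_span_le_ncard_of_finite (Finset.finite_toSet _)).trans ?_
    rw [Set.ncard_coe_finset]
    exact Finset.card_image_le
  refine ⟨.of_spanFinrank_maximalIdeal_le _ ?_, by omega⟩
  have h1 := ringKrullDim_le_ringKrullDim_quotient_add_card {x} (by
    simpa [Ring.jacobson_eq_sInf_isMaximal] using fun P hP => eq_maximalIdeal hP ▸ hx)
  rw [← IsRegularLocalRing.spanFinrank_maximalIdeal (R := R), Finset.coe_singleton,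
    Finset.card_singleton] at h1
  have h2 : (((maximalIdeal (R ⧸ Ideal.span {x})).spanFinrank : WithBot ℕ∞) + 1) ≤
      ringKrullDim (R ⧸ Ideal.span {x}) + 1 :=
    le_trans (by exact_mod_cast (by omega)) h1
  obtain ⟨d, hd⟩ := WithBot.ne_bot_iff_exists.mp
    (ringKrullDim_ne_bot (R := R ⧸ Ideal.span {x}))
  rw [← hd] at h2 ⊢
  have h3 : ((maximalIdeal (R ⧸ Ideal.span {x})).spanFinrank : ℕ∞) + 1 ≤ d + 1 := by
    exact_mod_cast h2
  exact_mod_cast (ENat.add_le_add_iff_right ENat.one_ne_top).mp h3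

/-- Prime avoidance. The maximal ideal lies neither in its square, by Nakayama, nor in a minimal
prime, since the dimension is positive. -/
lemma exists_mem_maximalIdeal_notMem (hbot : maximalIdeal R ≠ ⊥) :
    ∃ x ∈ maximalIdeal R, x ∉ maximalIdeal R ^ 2 ∧ ∀ P ∈ minimalPrimes R, x ∉ P := by
  classical
  by_contra! hcon
  let s : Finset (Ideal R) :=
    insert (maximalIdeal R ^ 2) (minimalPrimes.finite_of_isNoetherianRing R).toFinset
  have hcover : (maximalIdeal R : Set R) ⊆ ⋃ I ∈ (s : Set (Ideal R)), (I : Set R) := by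
    intro x hx
    by_cases hx2 : x ∈ maximalIdeal R ^ 2
    · exact Set.mem_biUnion (show maximalIdeal R ^ 2 ∈ (s : Set (Ideal R)) by simp [s]) hx2
    · obtain ⟨P, hP, hxP⟩ := hcon x hx hx2
      exact Set.mem_biUnion (show P ∈ (s : Set (Ideal R)) by simp [s, hP]) hxP
  -- Prime avoidance tolerates two ideals that need not be prime; both places are filled by the
  -- square of the maximal ideal.
  obtain ⟨I, hI, hle⟩ := (Ideal.subset_union_prime (f := id) (maximalIdeal R ^ 2)
    (maximalIdeal R ^ 2) (by
      intro P hP hne _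
      have hP' : P ∈ minimalPrimes R := by simpa [s, hne] using hP
      exact hP'.1.1)).mp hcover
  have h0 : (maximalIdeal R).spanFinrank ≠ 0 := fun h =>
    hbot ((Submodule.spanFinrank_eq_zero_iff_eq_bot (maximalIdeal R).fg_of_isNoetherianRing).mp h)
  rcases Finset.mem_insert.mp hI with rfl | hI
  · refine hbot (Submodule.eq_bot_of_le_smul_of_le_jacobson_bot (maximalIdeal R) _
      (maximalIdeal R).fg_of_isNoetherianRing ?_ (maximalIdeal_le_jacobson _))
    rwa [smul_eq_mul, ← pow_two]
  · have hI' : I ∈ minimalPrimes R := by simpa using hI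
    have hIp : I.IsPrime := hI'.1.1
    have hIm : maximalIdeal R = I := le_antisymm hle (le_maximalIdeal_of_isPrime I)
    have := IsRegularLocalRing.spanFinrank_maximalIdeal (R := R)
    rw [← maximalIdeal_height_eq_ringKrullDim, hIm, Ideal.height_eq_zero_iff.mpr hI', ← hIm] at this
    exact h0 (by exact_mod_cast this)

/-- Induction on the embedding dimension. With `x` as above, `R/(x)` is a domain, so `(x)` is prime
and contains a minimal prime `P`. As `x ∉ P`, one gets `P = xP`, and `P = 0` by Nakayama. -/
theorem isDomain_of_isRegularLocalRing : IsDomain R := by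
  induction hd : (maximalIdeal R).spanFinrank using Nat.strong_induction_on generalizing R with
  | _ d ih =>
  by_cases hbot : maximalIdeal R = ⊥
  · exact ((isField_iff_maximalIdeal_eq).mpr hbot).isDomain
  obtain ⟨x, hx, hx2, hxP⟩ := exists_mem_maximalIdeal_notMem hbot
  obtain ⟨hreg, hlt⟩ := isRegularLocalRing_quotient hx hx2
  have := ih _ (hd ▸ hlt) rfl
  have hprime : (Ideal.span {x}).IsPrime := (Ideal.Quotient.isDomain_iff_prime _).mp this
  obtain ⟨P, hP, hle⟩ := Ideal.exists_minimalPrimes_le (bot_le : ⊥ ≤ Ideal.span {x})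
  have hPp : P.IsPrime := hP.1.1
  have hP0 : P = ⊥ := by
    refine Submodule.eq_bot_of_le_smul_of_le_jacobson_bot (maximalIdeal R) P
      P.fg_of_isNoetherianRing (fun p hp => ?_) (maximalIdeal_le_jacobson _)
    obtain ⟨r, rfl⟩ := Ideal.mem_span_singleton.mp (hle hp)
    exact Submodule.smul_mem_smul hx ((hPp.mem_or_mem hp).resolve_left (hxP P hP))
  rw [hP0] at hPp
  have : NoZeroDivisors R := ⟨fun h => by simpa using hPp.mem_or_mem (by simpa using h)⟩
  exact NoZeroDivisors.to_isDomain R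

/-- A regular local ring of dimension at least two has depth at least two. -/
lemma ringKrullDim_le_one_of_colon {b c : R} (hb : b ≠ 0) (hc : c ∉ Ideal.span {b})
    (hm : ∀ z ∈ maximalIdeal R, z * c ∈ Ideal.span {b}) : ringKrullDim R ≤ 1 := by
  have := isDomain_of_isRegularLocalRing (R := R)
  have hbot : maximalIdeal R ≠ ⊥ := by
    intro h
    have : IsUnit b := by
      by_contra hbu
      exact hb (by simpa [h] using (mem_maximalIdeal b).mpr hbu)
    exact hc (by simp [Ideal.span_singleton_eq_top.mpr this])
  obtain ⟨x, hx, hx2, -⟩ := exists_mem_maximalIdeal_notMem hbot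
  obtain ⟨hreg, -⟩ := isRegularLocalRing_quotient hx hx2
  have := isDomain_of_isRegularLocalRing (R := R ⧸ Ideal.span {x})
  have hprime : (Ideal.span {x}).IsPrime := (Ideal.Quotient.isDomain_iff_prime _).mp this
  -- If `y` were in the maximal ideal but not in the prime `(x)`, then `xc = bg` and `yc = bh` would
  -- give `yg = xh`, so `x` divides `g`. Cancelling `x` would put `c` in `(b)`.
  have hle : maximalIdeal R ≤ Ideal.span {x} := by
    intro y hy
    by_contra hyx
    obtain ⟨g, hg⟩ := Ideal.mem_span_singleton.mp (hm x hx)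
    obtain ⟨h, hh⟩ := Ideal.mem_span_singleton.mp (hm y hy)
    have h1 : y * g = x * h := mul_left_cancel₀ hb (by linear_combination x * hh - y * hg)
    have h2 : g ∈ Ideal.span {x} := (hprime.mem_or_mem
      (Ideal.mem_span_singleton.mpr ⟨h, h1⟩)).resolve_left hyx
    obtain ⟨g', rfl⟩ := Ideal.mem_span_singleton.mp h2
    have hx0 : x ≠ 0 := fun h => hx2 (h ▸ zero_mem _)
    exact hc (Ideal.mem_span_singleton.mpr
      ⟨g', mul_left_cancel₀ hx0 (by linear_combination hg)⟩)
  rw [← IsRegularLocalRing.spanFinrank_maximalIdeal, le_antisymm hle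
    (by simpa [Ideal.span_le] using hx)]
  have := Submodule.spanFinrank_span_le_ncard_of_finite (R := R) (Set.finite_singleton x)
  rw [Set.ncard_singleton] at this
  exact_mod_cast this

end RegularLocal

/-! ### Extension over codimension two, and Noether normalization -/

/-- On a regular domain, an element of the field of fractions that is regular in codimension one
is regular. -/
theorem exists_mul_eq_of_height_one {B K : Type u} [CommRing B] [IsDomain B] [IsNoetherianRing B]
    [Field K] [Algebra B K] [IsFractionRing B K] (q : Ideal B) [q.IsPrime]
    (hreg : ∀ (P : Ideal B) [P.IsPrime], P ≤ q → IsRegularLocalRing (Localization.AtPrime P))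
    (f : K) (hf : ∀ (P : Ideal B) [P.IsPrime], P ≤ q → P.height = 1 →
      ∃ a : B, ∃ s ∉ P, f * algebraMap B K s = algebraMap B K a) :
    ∃ a : B, ∃ s ∉ q, f * algebraMap B K s = algebraMap B K a := by
  by_contra! hcon
  obtain ⟨a, ⟨b, hb⟩, rfl⟩ := IsLocalization.exists_mk'_eq (nonZeroDivisors B) f
  have hb0 : b ≠ 0 := nonZeroDivisors.ne_zero hb
  have hfrac {s d : B} : IsLocalization.mk' K a ⟨b, hb⟩ * algebraMap B K s = algebraMap B K d ↔
      s * a = b * d := by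
    rw [← (IsFractionRing.injective B K).eq_iff, map_mul, map_mul, mul_comm (algebraMap B K b),
      ← IsLocalization.mk'_spec K a ⟨b, hb⟩]
    have hbK : algebraMap B K b ≠ 0 := by
      simpa using (IsFractionRing.injective B K).ne hb0
    constructor
    · intro h
      linear_combination algebraMap B K b * h
    · intro h
      exact mul_right_cancel₀ hbK (by linear_combination h)
  -- `J t` is the ideal of denominators of `t f`, where `f = a/b`. If `f` is not regular at `q`,
  -- then `J 1 ≤ q`.
  let J (t : B) : Ideal B := Submodule.comap (LinearMap.mulRight B (t * a)) (Ideal.span {b})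
  have hJ {s t : B} : s ∈ J t ↔ s * (t * a) ∈ Ideal.span {b} := Iff.rfl
  have hJ1 : J 1 ≤ q := by
    intro s hs
    by_contra hsq
    obtain ⟨d, hd⟩ := Ideal.mem_span_singleton.mp (hJ.mp hs)
    exact hcon d s hsq (hfrac.mpr (by rw [← hd, one_mul]))
  obtain ⟨P, ⟨⟨t, rfl⟩, hPq⟩, hmax⟩ := set_has_maximal_iff_noetherian.mpr
    (inferInstanceAs (IsNoetherian B B))
    {I | (∃ t, I = J t) ∧ I ≤ q} ⟨_, ⟨1, rfl⟩, hJ1⟩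
  -- As for associated primes: an ideal of denominators maximal among those inside `q` is prime.
  -- Enlarging `t` to `t * s` can only enlarge the ideal, so it changes nothing as long as the
  -- result stays inside `q`.
  have hprime : (J t).IsPrime := by
    refine ⟨fun h => Ideal.IsPrime.ne_top ‹_› (top_le_iff.mp (h ▸ hPq)), ?_⟩
    have step (s : B) (hs : J (t * s) ≤ q) : J (t * s) ≤ J t := by
      by_contra hlt
      refine hmax _ ⟨⟨_, rfl⟩, hs⟩ ⟨?_, hlt⟩
      intro w hw
      rw [hJ] at hw ⊢
      convert! Ideal.mul_mem_left _ s hw using 1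
      ring
    intro u v huv
    by_cases hu : J (t * u) ≤ q
    · right
      apply step u hu
      rw [hJ] at huv ⊢
      convert! huv using 1
      ring
    · left
      obtain ⟨s, hs, hsq⟩ := SetLike.not_le_iff_exists.mp hu
      have h1 : J (t * s) ≤ q := by
        intro w hw
        refine (Ideal.IsPrime.mem_or_mem ‹_› (hPq (?_ : w * s ∈ J t))).resolve_right hsq
        rw [hJ] at hw ⊢
        convert! hw using 1
        ring
      apply step s h1
      rw [hJ] at hs ⊢
      convert! hs using 1
      ring
  have := hreg (J t) hPq
  have hbP : b ∈ J t := hJ.mpr (Ideal.mul_mem_right _ _ (Ideal.mem_span_singleton_self b))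
  -- After localizing at `J t`, the element `t a` is not in `(b)`, but the maximal ideal multiplies
  -- it into `(b)`. So the depth is at most one.
  have hdim : ringKrullDim (Localization.AtPrime (J t)) ≤ 1 := by
    refine ringKrullDim_le_one_of_colon (b := algebraMap B _ b) (c := algebraMap B _ (t * a))
      ?_ ?_ ?_
    · simpa using (IsLocalization.injective (Localization.AtPrime (J t)) (J t).primeCompl_le_nonZeroDivisors).ne hb0
    · rw [← Set.image_singleton, ← Ideal.map_span,
        IsLocalization.algebraMap_mem_map_algebraMap_iff (J t).primeCompl]
      rintro ⟨s, hs, hst⟩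
      exact hs (hJ.mpr hst)
    · intro z hz
      rw [← IsLocalization.AtPrime.map_eq_maximalIdeal (J t),
        IsLocalization.mem_map_algebraMap_iff (J t).primeCompl] at hz
      obtain ⟨⟨⟨p, hp⟩, s⟩, hps⟩ := hz
      have hu := IsLocalization.map_units (Localization.AtPrime (J t)) s
      rw [← Ideal.unit_mul_mem_iff_mem _ hu, ← mul_assoc, mul_comm (algebraMap _ _ _), hps,
        ← map_mul, ← Set.image_singleton, ← Ideal.map_span]
      exact Ideal.mem_map_of_mem _ (hJ.mp hp)
  have hheight : (J t).height = 1 := by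
    rw [IsLocalization.AtPrime.ringKrullDim_eq_height (J t)] at hdim
    refine le_antisymm (by exact_mod_cast hdim) (Order.one_le_iff_ne_zero.mpr fun h => ?_)
    rw [Ideal.height_eq_zero_iff_eq_bot] at h
    exact hb0 (by simpa [h] using hbP)
  -- Regularity of `f` at this height-one prime gives a denominator of `f` outside `J t`, but it is
  -- also a denominator of `t f`.
  obtain ⟨d, s, hs, hds⟩ := hf (J t) hPq hheight
  rw [hfrac] at hds
  refine hs (hJ.mpr (Ideal.mem_span_singleton.mpr ⟨t * d, ?_⟩))
  linear_combination t * hds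

/-- Noether normalization: `B` is finite over a polynomial ring in `n` variables, and going-up lifts
a chain of length `n` to `B`. -/
lemma natCast_le_ringKrullDim_of_trdeg_eq {E B : Type u} [Field E] [CommRing B] [IsDomain B]
    [Algebra E B] [Algebra.FiniteType E B] {n : ℕ} (hB : Algebra.trdeg E B = n) :
    (n : WithBot ℕ∞) ≤ ringKrullDim B := by
  obtain ⟨s, g, hg, hgfin⟩ := exists_finite_inj_algHom_of_fg E B
  let P := MvPolynomial (Fin s) E
  let : Algebra P B := g.toRingHom.toAlgebra
  have : IsScalarTower E P B := .of_algebraMap_eq fun r => (g.commutes r).symm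
  have : FaithfulSMul P B := (faithfulSMul_iff_algebraMap_injective P B).mpr hg
  have : Algebra.IsIntegral P B := ⟨RingHom.Finite.to_isIntegral hgfin⟩
  have hs : s = n := by
    have := lift_trdeg_add_eq E P B
    rw [trdeg_eq_zero (R := P), MvPolynomial.trdeg_of_isDomain, hB] at this
    exact_mod_cast (by simpa using this)
  have hP : ringKrullDim P = s := by
    rw [MvPolynomial.ringKrullDim_of_isNoetherianRing]
    simp
  obtain ⟨p, hp⟩ := Order.le_krullDim_iff.mp hP.ge
  obtain ⟨Q, -, hQ, hQp⟩ := Ideal.exists_ideal_over_prime_of_isIntegral (S := B)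
    p.head.asIdeal ⊥ (by simp [← RingHom.ker_eq_comap_bot,
      (RingHom.injective_iff_ker_eq_bot _).mp (FaithfulSMul.algebraMap_injective P B)])
  have : Q.LiesOver p.head.asIdeal := ⟨hQp.symm⟩
  obtain ⟨L, hL, -⟩ := Ideal.exists_ltSeries_of_hasGoingUp p Q
  rw [← hs, ← hp, ← hL]
  exact Order.le_krullDim_iff.mpr ⟨L, rfl⟩

/-! ### Local rings and dimension of schemes of finite type -/

section Schemes

variable (E : Type u) [Field E] {X : Scheme.{u}} [X.Over (Spec (.of E))]

/-- The sections of an `E`-scheme form an `E`-algebra. -/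
noncomputable instance sectionsAlgebra (U : X.Opens) : Algebra E Γ(X, U) :=
  ((Scheme.ΓSpecIso (.of E)).inv ≫ (X ↘ Spec (.of E)).appTop ≫
    X.presheaf.map (homOfLE le_top).op).hom.toAlgebra

/-- The stalks of an `E`-scheme are `E`-algebras. -/
noncomputable instance stalkAlgebra (x : X) : Algebra E (X.presheaf.stalk x) :=
  ((Scheme.ΓSpecIso (.of E)).inv ≫ (X ↘ Spec (.of E)).appTop ≫
    X.presheaf.germ ⊤ x trivial).hom.toAlgebra

lemma germ_algebraMap {U : X.Opens} {x : X} (hx : x ∈ U) (e : E) :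
    X.presheaf.germ U x hx (algebraMap E Γ(X, U) e) = algebraMap E (X.presheaf.stalk x) e := by
  simp [RingHom.algebraMap_toAlgebra]

lemma stalkSpecializes_algebraMap {x y : X} (h : x ⤳ y) (e : E) :
    X.presheaf.stalkSpecializes h (algebraMap E (X.presheaf.stalk y) e) =
      algebraMap E (X.presheaf.stalk x) e := by
  rw [← germ_algebraMap E (U := ⊤) trivial, ← germ_algebraMap E (U := ⊤) trivial]
  exact TopCat.Presheaf.germ_stalkSpecializes_apply ..

instance isScalarTower_stalk_functionField [IsIntegral X] (x : X) :
    IsScalarTower E (X.presheaf.stalk x) X.functionField :=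
  .of_algebraMap_eq fun e => (stalkSpecializes_algebraMap E _ e).symm

instance isScalarTower_sections_stalk (U : X.Opens) (x : U) :
    IsScalarTower E Γ(X, U) (X.presheaf.stalk x) :=
  .of_algebraMap_eq fun e => (germ_algebraMap E x.2 e).symm

instance isScalarTower_sections_functionField [IsIntegral X] (U : X.Opens) [Nonempty U] :
    IsScalarTower E Γ(X, U) X.functionField :=
  .of_algebraMap_eq fun e => (germ_algebraMap E _ e).symm

variable [LocallyOfFiniteType (X ↘ Spec (.of E))]

lemma finiteType_sections {U : X.Opens} (hU : IsAffineOpen U) : Algebra.FiniteType E Γ(X, U) := by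
  have h := (X ↘ Spec (.of E)).finiteType_appLE (isAffineOpen_top (Spec (.of E))) hU le_top
  have h2 := h.comp (RingHom.FiniteType.of_surjective (Scheme.ΓSpecIso (.of E)).inv.hom
    (ConcreteCategory.bijective_of_isIso (Scheme.ΓSpecIso (.of E)).inv).2)
  exact h2

lemma essFiniteType_stalk (x : X) : Algebra.EssFiniteType E (X.presheaf.stalk x) := by
  obtain ⟨_, ⟨U, hU, rfl⟩, hxU, -⟩ := X.isBasis_affineOpens.exists_subset_of_mem_open
    (Set.mem_univ x) isOpen_univ
  have := finiteType_sections E hU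
  let x' : U := ⟨x, hxU⟩
  let := X.presheaf.algebra_section_stalk x'
  have := hU.isLocalization_stalk x'
  have : Algebra.EssFiniteType Γ(X, U) (X.presheaf.stalk x) :=
    .of_isLocalization _ (hU.primeIdealOf x').asIdeal.primeCompl
  have := isScalarTower_sections_stalk E U x'
  exact .comp E Γ(X, U) (X.presheaf.stalk x)

lemma isNoetherianRing_stalk_of_finiteType (E : Type u) [Field E] {X : Scheme.{u}}
    [X.Over (Spec (.of E))] [LocallyOfFiniteType (X ↘ Spec (.of E))] (x : X) :
    IsNoetherianRing (X.presheaf.stalk x) :=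
  have := essFiniteType_stalk E x
  Algebra.EssFiniteType.isNoetherianRing E _

/-- An affine open bounds the transcendence degree by `dim X`. Conversely, the local ring at the
most special point of a chain of length `l` has dimension at least `l` and at most the transcendence
degree. -/
lemma trdeg_functionField_eq [IsIntegral X] {l : ℕ} (hl : topologicalKrullDim X = l) :
    Algebra.trdeg E X.functionField = l := by
  obtain ⟨_, ⟨U, hU, rfl⟩, hxU, -⟩ := X.isBasis_affineOpens.exists_subset_of_mem_open
    (Set.mem_univ (genericPoint X)) isOpen_univ
  have : Nonempty U := ⟨_, hxU⟩
  have := finiteType_sections E hU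
  have := functionField_isFractionRing_of_isAffineOpen X U hU
  obtain ⟨n, hn⟩ := Cardinal.lt_aleph0.mp (trdeg_lt_aleph0_of_finiteType (R := E) (S := Γ(X, U)))
  have hK : Algebra.trdeg E X.functionField = n := by
    rw [← hn, trdeg_eq_of_isFractionRing (R := Γ(X, U)) (K := X.functionField)]
  have h1 : n ≤ l := by
    have hdim := natCast_le_ringKrullDim_of_trdeg_eq hn
    rw [← PrimeSpectrum.topologicalKrullDim_eq_ringKrullDim] at hdim
    have := hU.isOpenImmersion_fromSpec
    have h2 := hU.fromSpec.isOpenEmbedding.isInducing.topologicalKrullDim_le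
    rw [hl] at h2
    exact_mod_cast le_trans hdim h2
  have h2 : l ≤ n := by
    rw [topologicalKrullDim, Order.krullDim_eq_of_orderIso irreducibleSetEquivPoints] at hl
    obtain ⟨p, rfl⟩ := Order.le_krullDim_iff.mp hl.ge
    have := isNoetherianRing_stalk_of_finiteType E p.head
    have := ringKrullDim_stalk_eq_coheight p.head
    have hR : Algebra.trdeg E (X.presheaf.stalk p.head) = n := by
      rw [← hK, trdeg_eq_of_isFractionRing (K := X.functionField)]
    obtain ⟨d, hd⟩ : ∃ d : ℕ, ringKrullDim (X.presheaf.stalk p.head) = d := by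
      rw [← IsLocalRing.maximalIdeal_height_eq_ringKrullDim]
      obtain ⟨d, hd⟩ := ENat.ne_top_iff_exists.mp (Ideal.height_ne_top
        (IsLocalRing.maximalIdeal.isMaximal (X.presheaf.stalk p.head)).ne_top)
      exact ⟨d, by rw [← hd]; rfl⟩
    obtain ⟨r, -, hr⟩ := trdeg_residueField_add_le hR hd
    have hlen : (p.length : ℕ∞) ≤ Order.coheight p.head := Order.length_le_coheight le_rfl
    rw [ringKrullDim_stalk_eq_coheight] at hd
    have : (p.length : WithBot ℕ∞) ≤ d := hd ▸ (by exact_mod_cast hlen)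
    have : p.length ≤ d := by exact_mod_cast this
    omega
  rw [hK, le_antisymm h1 h2]

end Schemes

/-! ### Birational morphisms and function fields -/

section FunctionField

variable {X Y : Scheme.{u}} [IsIntegral X] [IsIntegral Y] {π : Y ⟶ X}

lemma IsBirational.map_genericPoint (hπ : IsBirational π) :
    π (genericPoint Y) = genericPoint X := by
  obtain ⟨f, hf⟩ := hπ
  have : Nonempty f.source := f.dense_source.nonempty.to_subtype
  have : Nonempty f.target := f.dense_target.nonempty.to_subtype
  have h1 := genericPoint_eq_of_isOpenImmersion f.source.ι
  have h2 := genericPoint_eq_of_isOpenImmersion (f.iso.hom ≫ f.target.ι)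
  rw [hf, Scheme.Hom.comp_apply, h1] at h2
  exact h2

/-- The generic point lies in the open set on which `π` is an open immersion. -/
lemma IsBirational.isIso_stalkMap_genericPoint {X Y : Scheme.{u}} [IsIntegral Y] {π : Y ⟶ X}
    (hπ : IsBirational π) : IsIso (π.stalkMap (genericPoint Y)) := by
  obtain ⟨f, hf⟩ := hπ
  have : Nonempty f.source := f.dense_source.nonempty.to_subtype
  rw [← genericPoint_eq_of_isOpenImmersion f.source.ι]
  have h := Scheme.Hom.stalkMap_comp f.source.ι π (genericPoint f.source)
  have : IsIso ((f.source.ι ≫ π).stalkMap (genericPoint f.source)) := by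
    rw [← hf]
    infer_instance
  rw [h] at this
  exact @IsIso.of_isIso_comp_right _ _ _ _ _ _ (f.source.ι.stalkMap _) inferInstance this

/-- The map of function fields induced by a morphism that preserves generic points. -/
noncomputable def functionFieldMap (hπ : π (genericPoint Y) = genericPoint X) :
    X.functionField ⟶ Y.functionField :=
  X.presheaf.stalkSpecializes (specializes_of_eq hπ) ≫ π.stalkMap (genericPoint Y)

lemma SpecMap_functionFieldMap (hπ : π (genericPoint Y) = genericPoint X) :
    Spec.map (functionFieldMap hπ) ≫ X.fromSpecStalk (genericPoint X) =
      Y.fromSpecStalk (genericPoint Y) ≫ π := by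
  rw [functionFieldMap, Spec.map_comp, Category.assoc, Scheme.SpecMap_stalkSpecializes_fromSpecStalk,
    Scheme.SpecMap_stalkMap_fromSpecStalk]

lemma IsBirational.isIso_functionFieldMap (hπ : IsBirational π) :
    IsIso (functionFieldMap hπ.map_genericPoint) := by
  have := hπ.isIso_stalkMap_genericPoint
  have : IsIso (X.presheaf.stalkSpecializes (specializes_of_eq hπ.map_genericPoint)) :=
    (X.presheaf.stalkCongr (.of_eq hπ.map_genericPoint.symm)).isIso_hom
  rw [functionFieldMap]
  infer_instance

lemma functionFieldMap_algebraMap {E : Type u} [Field E] [X.Over (Spec (.of E))]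
    [Y.Over (Spec (.of E))] [π.IsOver (Spec (.of E))] (hπ : π (genericPoint Y) = genericPoint X)
    (e : E) : functionFieldMap hπ (algebraMap E X.functionField e) =
      algebraMap E Y.functionField e := by
  rw [functionFieldMap, CommRingCat.comp_apply]
  erw [stalkSpecializes_algebraMap]
  have h : (X ↘ Spec (.of E)).appTop ≫ X.presheaf.germ ⊤ (π (genericPoint Y)) trivial ≫
      π.stalkMap (genericPoint Y) =
      (Y ↘ Spec (.of E)).appTop ≫ Y.presheaf.germ ⊤ (genericPoint Y) trivial := by
    refine (congrArg ((X ↘ Spec (.of E)).appTop ≫ ·)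
      (π.germ_stalkMap ⊤ (genericPoint Y) trivial)).trans ?_
    simp only [← comp_over π (Spec (.of E)), Scheme.Hom.comp_appTop, Category.assoc]
    rfl
  exact congr($h ((Scheme.ΓSpecIso (.of E)).inv e))

lemma IsBirational.exists_algEquiv {E : Type u} [Field E] [X.Over (Spec (.of E))]
    [Y.Over (Spec (.of E))] [π.IsOver (Spec (.of E))] (hπ : IsBirational π) :
    ∃ j : X.functionField ≃ₐ[E] Y.functionField,
      Spec.map (CommRingCat.ofHom (j : X.functionField →+* Y.functionField)) ≫
        X.fromSpecStalk (genericPoint X) = Y.fromSpecStalk (genericPoint Y) ≫ π := by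
  have := hπ.isIso_functionFieldMap
  let j : X.functionField ≃ₐ[E] Y.functionField :=
    AlgEquiv.ofRingEquiv (f := (asIso (functionFieldMap hπ.map_genericPoint)).commRingCatIsoToRingEquiv)
      (functionFieldMap_algebraMap hπ.map_genericPoint)
  exact ⟨j, SpecMap_functionFieldMap hπ.map_genericPoint⟩

end FunctionField

/-! ### Local rings of `Y` inside the function field of `X` -/

section StalkSubalgebra

variable {E : Type u} [Field E] {X Y : Scheme.{u}} [IsIntegral X] [IsIntegral Y]
  [X.Over (Spec (.of E))] [Y.Over (Spec (.of E))] (j : X.functionField ≃ₐ[E] Y.functionField)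

/-- The inclusion of a local ring of `Y` into the function field of a scheme `X` with the same
function field. -/
noncomputable def stalkToFunctionField (y : Y) : Y.presheaf.stalk y →ₐ[E] X.functionField :=
  (j.symm : Y.functionField →ₐ[E] X.functionField).comp
    (IsScalarTower.toAlgHom E (Y.presheaf.stalk y) Y.functionField)

lemma stalkToFunctionField_injective (y : Y) : Function.Injective (stalkToFunctionField j y) :=
  j.symm.injective.comp (IsFractionRing.injective (Y.presheaf.stalk y) Y.functionField)

/-- The local ring of `Y` at `y` as a subalgebra of the function field of `X`. -/
noncomputable def stalkSubalgebra (y : Y) : Subalgebra E X.functionField :=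
  (stalkToFunctionField j y).range

/-- The local ring of `Y` at `y` is isomorphic to its image in the function field of `X`. -/
noncomputable def stalkEquiv (y : Y) : Y.presheaf.stalk y ≃ₐ[E] stalkSubalgebra j y :=
  AlgEquiv.ofInjective _ (stalkToFunctionField_injective j y)

lemma mem_stalkSubalgebra_iff {y : Y} {f : X.functionField} :
    f ∈ stalkSubalgebra j y ↔
      j f ∈ Set.range (algebraMap (Y.presheaf.stalk y) Y.functionField) := by
  constructor
  · rintro ⟨a, rfl⟩
    exact ⟨a, (j.apply_symm_apply _).symm⟩
  · rintro ⟨a, ha⟩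
    exact ⟨a, j.injective ((j.apply_symm_apply _).trans ha)⟩

lemma algebraMap_stalkSpecializes {p y : Y} (h : p ⤳ y) (a : Y.presheaf.stalk y) :
    algebraMap (Y.presheaf.stalk p) Y.functionField (Y.presheaf.stalkSpecializes h a) =
      algebraMap (Y.presheaf.stalk y) Y.functionField a := by
  simp only [RingHom.algebraMap_toAlgebra]
  exact TopCat.Presheaf.stalkSpecializes_comp_apply ..

lemma stalkSubalgebra_mono {p y : Y} (h : p ⤳ y) : stalkSubalgebra j y ≤ stalkSubalgebra j p := by
  rintro _ ⟨a, rfl⟩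
  refine ⟨Y.presheaf.stalkSpecializes h a, ?_⟩
  exact congr(j.symm $(algebraMap_stalkSpecializes h a))

instance isFractionRing_stalkSubalgebra (y : Y) :
    IsFractionRing (stalkSubalgebra j y) X.functionField := by
  refine .of_field _ _ fun z => ?_
  obtain ⟨a, b, hb, hab⟩ := IsFractionRing.div_surjective (A := Y.presheaf.stalk y) (j z)
  refine ⟨stalkEquiv j y a, stalkEquiv j y b, j.injective ?_⟩
  rw [← hab, map_div₀]
  exact congr_arg₂ (· / ·) (j.apply_symm_apply _).symm (j.apply_symm_apply _).symm

instance essFiniteType_stalkSubalgebra [LocallyOfFiniteType (Y ↘ Spec (.of E))] (y : Y) :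
    Algebra.EssFiniteType E (stalkSubalgebra j y) :=
  have := essFiniteType_stalk E y
  (Algebra.EssFiniteType.iff_of_algEquiv (stalkEquiv j y)).mp this

lemma isRegularLocalRing_stalkSubalgebra {y : Y} (hy : IsRegularLocalRing (Y.presheaf.stalk y)) :
    IsRegularLocalRing (stalkSubalgebra j y) :=
  .of_ringEquiv (stalkEquiv j y).toRingEquiv

/-- This translates between stalks and the coordinate ring of an affine chart, in the form used by
`exists_mul_eq_of_height_one`. -/
lemma mem_range_algebraMap_atPrime_iff {R A K : Type*} [CommRing R] [CommRing A] [Field K]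
    [Algebra R A] [Algebra R K] [Algebra A K] [IsScalarTower R A K] [FaithfulSMul R K]
    (P : Ideal R) [P.IsPrime] [IsLocalization.AtPrime A P] {g : K} :
    g ∈ Set.range (algebraMap A K) ↔
      ∃ a : R, ∃ s ∉ P, g * algebraMap R K s = algebraMap R K a := by
  constructor
  · rintro ⟨z, rfl⟩
    obtain ⟨a, s, rfl⟩ := IsLocalization.exists_mk'_eq P.primeCompl z
    refine ⟨a, s, s.2, ?_⟩
    rw [IsScalarTower.algebraMap_apply R A K, IsScalarTower.algebraMap_apply R A K, ← map_mul,
      IsLocalization.mk'_spec]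
  · rintro ⟨a, s, hs, h⟩
    have hs0 : algebraMap R K s ≠ 0 := by
      rw [Ne, FaithfulSMul.algebraMap_eq_zero_iff]
      rintro rfl
      exact hs P.zero_mem
    refine ⟨IsLocalization.mk' A a (⟨s, hs⟩ : P.primeCompl), ?_⟩
    apply mul_right_cancel₀ hs0
    rw [h, IsScalarTower.algebraMap_apply R A K, IsScalarTower.algebraMap_apply R A K, ← map_mul]
    congr 1
    exact IsLocalization.mk'_spec A a (⟨s, hs⟩ : P.primeCompl)

lemma mem_range_stalk_iff {Y : Scheme.{u}} [IsIntegral Y] {V : Y.Opens} (hV : IsAffineOpen V)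
    (x : V) {g : Y.functionField} :
    letI : Nonempty V := ⟨x⟩
    g ∈ Set.range (algebraMap (Y.presheaf.stalk (x : Y)) Y.functionField) ↔
      ∃ a : Γ(Y, V), ∃ s ∉ (hV.primeIdealOf x).asIdeal,
        g * algebraMap Γ(Y, V) Y.functionField s = algebraMap Γ(Y, V) Y.functionField a := by
  let : Nonempty V := ⟨x⟩
  have := hV.isLocalization_stalk x
  have := functionField_isFractionRing_of_isAffineOpen Y V hV
  exact mem_range_algebraMap_atPrime_iff _

/-- A rational function on a regular scheme that is regular in codimension one near a point is
regular at the point. -/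
lemma mem_stalkSubalgebra_of_coheight_one [LocallyOfFiniteType (Y ↘ Spec (.of E))]
    (hreg : ∀ y : Y, IsRegularLocalRing (Y.presheaf.stalk y)) {y : Y} {f : X.functionField}
    (hf : ∀ p : Y, p ⤳ y → Order.coheight p = 1 → f ∈ stalkSubalgebra j p) :
    f ∈ stalkSubalgebra j y := by
  obtain ⟨_, ⟨V, hV, rfl⟩, hyV, -⟩ := Y.isBasis_affineOpens.exists_subset_of_mem_open
    (Set.mem_univ y) isOpen_univ
  let y' : V := ⟨y, hyV⟩
  let : Nonempty V := ⟨y'⟩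
  have := finiteType_sections E hV
  have : IsNoetherianRing Γ(Y, V) := Algebra.FiniteType.isNoetherianRing E _
  have := functionField_isFractionRing_of_isAffineOpen Y V hV
  -- Primes of the chart contained in the prime of `y` are the generizations of `y`, and their
  -- localizations are the stalks there.
  have key (P : Ideal Γ(Y, V)) [hP : P.IsPrime] (hPy : P ≤ (hV.primeIdealOf y').asIdeal) :
      ∃ p : V, (p : Y) ⤳ y ∧ IsLocalization.AtPrime (Y.presheaf.stalk (p : Y)) P := by
    have h : hV.fromSpec ⟨P, hP⟩ ∈ V :=
      hV.range_fromSpec.le (Set.mem_range_self _)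
    refine ⟨⟨_, h⟩, ?_, hV.isLocalization_stalk' ⟨P, hP⟩ h⟩
    have hsp : (⟨P, hP⟩ : PrimeSpectrum Γ(Y, V)) ⤳ hV.primeIdealOf y' :=
      (PrimeSpectrum.le_iff_specializes _ _).mp hPy
    have := hsp.map hV.fromSpec.continuous
    rwa [hV.fromSpec_primeIdealOf] at this
  rw [mem_stalkSubalgebra_iff]
  refine (mem_range_stalk_iff hV y').mpr (exists_mul_eq_of_height_one _ ?_ _ ?_)
  · intro P hP hPy
    obtain ⟨p, -, hp⟩ := key P hPy
    have := hreg p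
    exact .of_ringEquiv (IsLocalization.algEquiv P.primeCompl (Y.presheaf.stalk (p : Y))
      (Localization.AtPrime P)).toRingEquiv
  · intro P hP hPy hP1
    obtain ⟨p, hpy, hp⟩ := key P hPy
    refine (mem_range_algebraMap_atPrime_iff (A := Y.presheaf.stalk (p : Y)) P).mp ?_
    rw [← mem_stalkSubalgebra_iff]
    refine hf p hpy ?_
    have := ringKrullDim_stalk_eq_coheight (p : Y)
    rw [IsLocalization.AtPrime.ringKrullDim_eq_height P, hP1] at this
    exact_mod_cast this.symm

/-- Elements of the local ring at a generization of `y` are fractions of elements of the local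
ring at `y`. -/
lemma exists_mul_eq_of_specializes {p y : Y} (h : p ⤳ y) {g : X.functionField}
    (hg : g ∈ stalkSubalgebra j p) :
    ∃ a ∈ stalkSubalgebra j y, ∃ s ∈ stalkSubalgebra j y,
      s ≠ 0 ∧ s⁻¹ ∈ stalkSubalgebra j p ∧ g * s = a := by
  obtain ⟨_, ⟨V, hV, rfl⟩, hyV, -⟩ := Y.isBasis_affineOpens.exists_subset_of_mem_open
    (Set.mem_univ y) isOpen_univ
  have hpV : p ∈ V := h.mem_open V.2 hyV
  let y' : V := ⟨y, hyV⟩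
  let p' : V := ⟨p, hpV⟩
  let : Nonempty V := ⟨y'⟩
  have := functionField_isFractionRing_of_isAffineOpen Y V hV
  rw [mem_stalkSubalgebra_iff] at hg
  obtain ⟨a, s, hs, has⟩ := (mem_range_stalk_iff hV p').mp hg
  have hmem (c : Γ(Y, V)) : j.symm (algebraMap _ _ c) ∈ stalkSubalgebra j y := by
    rw [mem_stalkSubalgebra_iff, j.apply_symm_apply]
    exact (mem_range_stalk_iff hV y').mpr ⟨c, 1, Ideal.one_notMem _, by rw [map_one, mul_one]⟩
  have hs0 : algebraMap Γ(Y, V) Y.functionField s ≠ 0 := by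
    rw [Ne, FaithfulSMul.algebraMap_eq_zero_iff]
    rintro rfl
    exact hs (Ideal.zero_mem _)
  refine ⟨_, hmem a, _, hmem s, by simpa using hs0, ?_, ?_⟩
  · rw [mem_stalkSubalgebra_iff, map_inv₀, j.apply_symm_apply]
    refine (mem_range_stalk_iff hV p').mpr ⟨1, s, hs, ?_⟩
    rw [inv_mul_cancel₀ hs0, map_one]
  · rw [← has, map_mul, j.symm_apply_apply]

end StalkSubalgebra

/-! ### Bases of differentials under localization -/

section LocalizedBasis

/-- If the elements of `R'` are fractions of elements of `R`, then a basis of `Ω_{R|E}` that maps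
to a basis of `Ω_{K|E}` also maps to a basis of `Ω_{R'|E}`. -/
lemma exists_basis_of_fractions {E R R' K : Type u} [CommRing E] [CommRing R] [CommRing R']
    [CommRing K] [Algebra E R] [Algebra E R'] [Algebra E K] [Algebra R R'] [Algebra R K]
    [Algebra R' K] [IsScalarTower E R R'] [IsScalarTower E R K] [IsScalarTower E R' K]
    [IsScalarTower R R' K] [FaithfulSMul R' K]
    (hR : ∀ g : R', ∃ a s : R, IsUnit (algebraMap R R' s) ∧ g * algebraMap R R' s = algebraMap R R' a)
    {n : ℕ} (b : Module.Basis (Fin n) R (Ω[R⁄E])) (b' : Module.Basis (Fin n) K (Ω[K⁄E]))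
    (h : ∀ i, KaehlerDifferential.map E E R K (b i) = b' i) :
    ∃ b'' : Module.Basis (Fin n) R' (Ω[R'⁄E]), ∀ i, KaehlerDifferential.map E E R' K (b'' i) = b' i := by
  let v : Fin n → Ω[R'⁄E] := fun i => KaehlerDifferential.map E E R R' (b i)
  have hv (i) : KaehlerDifferential.map E E R' K (v i) = b' i :=
    (kaehlerDifferential_map_map R' _).trans (h i)
  have hD (a : R) : KaehlerDifferential.D E R' (algebraMap R R' a) ∈
      Submodule.span R' (Set.range v) := by
    rw [← KaehlerDifferential.map_D E E R R', ← b.sum_repr (KaehlerDifferential.D E R a), map_sum]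
    refine Submodule.sum_mem _ fun i _ => ?_
    rw [map_smul, ← algebraMap_smul R']
    exact Submodule.smul_mem _ _ (Submodule.subset_span ⟨i, rfl⟩)
  have hli : LinearIndependent R' v := by
    rw [Fintype.linearIndependent_iff]
    intro c hc i
    have := congr(KaehlerDifferential.map E E R' K $hc)
    simp only [map_sum, map_smul, hv, map_zero] at this
    simp only [← algebraMap_smul K (c _)] at this
    have := Fintype.linearIndependent_iff.mp b'.linearIndependent _ this i
    rwa [FaithfulSMul.algebraMap_eq_zero_iff] at this
  refine ⟨.mk hli ?_, fun i => by rw [Module.Basis.mk_apply, hv]⟩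
  rw [← KaehlerDifferential.span_range_derivation E R', Submodule.span_le]
  rintro _ ⟨g, rfl⟩
  -- Quotient rule: `gs = a` gives `s dg = da - g ds`, and `s` is a unit in `R'`.
  obtain ⟨a, s, hs, has⟩ := hR g
  have := congr(KaehlerDifferential.D E R' $has)
  rw [Derivation.leibniz, ← eq_sub_iff_add_eq'] at this
  rw [SetLike.mem_coe, ← Submodule.smul_mem_iff_of_isUnit _ hs, this]
  exact Submodule.sub_mem _ (hD a) (Submodule.smul_mem _ _ (hD s))

end LocalizedBasis

/-! ### Regular forms at points of `Y` and at formal prime divisors -/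

section Regular

variable {E : Type u} [Field E] {X Y : Scheme.{u}} [IsIntegral X] [IsIntegral Y]
  [X.Over (Spec (.of E))] [Y.Over (Spec (.of E))]
  (j : X.functionField ≃ₐ[E] Y.functionField) {l : ℕ}

lemma exists_basis_kaehlerDifferential_stalkSubalgebra [CharZero E]
    [LocallyOfFiniteType (Y ↘ Spec (.of E))]
    (hK : Algebra.trdeg E X.functionField = l) (y : Y) (hy : IsRegularLocalRing (Y.presheaf.stalk y)) :
    ∃ (b : Module.Basis (Fin l) (stalkSubalgebra j y) (Ω[stalkSubalgebra j y⁄E]))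
      (b' : Module.Basis (Fin l) X.functionField (Ω[X.functionField⁄E])),
      ∀ i, KaehlerDifferential.map E E (stalkSubalgebra j y) X.functionField (b i) = b' i :=
  have := isRegularLocalRing_stalkSubalgebra j hy
  exists_basis_kaehlerDifferential hK

/-- On a regular scheme, a form that is regular in codimension one near a point is regular at the
point. -/
lemma mem_range_formsMap_of_coheight_one [CharZero E]
    [LocallyOfFiniteType (Y ↘ Spec (.of E))]
    (hK : Algebra.trdeg E X.functionField = l) {m : ℕ}
    (hreg : ∀ y : Y, IsRegularLocalRing (Y.presheaf.stalk y)) {y : Y} {η : RationalForms E X l m}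
    (hη : ∀ p : Y, p ⤳ y → Order.coheight p = 1 →
      η ∈ Set.range (formsMap E (stalkSubalgebra j p) X.functionField l m)) :
    η ∈ Set.range (formsMap E (stalkSubalgebra j y) X.functionField l m) := by
  obtain ⟨b, b', h⟩ := exists_basis_kaehlerDifferential_stalkSubalgebra j hK y (hreg y)
  refine (mem_range_formsMap_iff b b' h η).mpr fun i => ?_
  suffices (formsBasis b' l m).repr η i ∈ stalkSubalgebra j y from ⟨⟨_, this⟩, rfl⟩
  refine mem_stalkSubalgebra_of_coheight_one j hreg fun p hpy hp => ?_
  let := (Subalgebra.inclusion (stalkSubalgebra_mono j hpy)).toAlgebra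
  have : IsScalarTower (stalkSubalgebra j y) (stalkSubalgebra j p) X.functionField :=
    .of_algebraMap_eq fun _ => rfl
  have : IsScalarTower E (stalkSubalgebra j y) (stalkSubalgebra j p) :=
    .of_algebraMap_eq fun _ => rfl
  -- The basis at `y` also serves at the generization `p`, so the coefficients tested at `p` are
  -- those of the same basis `b'`.
  obtain ⟨b'', h''⟩ := exists_basis_of_fractions (R' := stalkSubalgebra j p) (fun g => by
    obtain ⟨a, ha, s, hs, hs0, hsinv, has⟩ := exists_mul_eq_of_specializes j hpy g.2
    refine ⟨⟨a, ha⟩, ⟨s, hs⟩, ?_, Subtype.ext has⟩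
    exact IsUnit.of_mul_eq_one ⟨s⁻¹, hsinv⟩ (Subtype.ext (mul_inv_cancel₀ hs0))) b b' h
  obtain ⟨c, hc⟩ := (mem_range_formsMap_iff b'' b' h'' η).mp (hη p hpy hp) i
  rw [← hc]
  exact c.2

/-- Regularity gives a free module of differentials, which permits descent from the completion of
the valuation ring. -/
lemma mem_range_formsMap_of_isRegularAt [CharZero E]
    [LocallyOfFiniteType (Y ↘ Spec (.of E))]
    (hK : Algebra.trdeg E X.functionField = l) {m : ℕ} {p : Y}
    (hreg : IsRegularLocalRing (Y.presheaf.stalk p)) {φ : FormalPrimeDivisor E X l}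
    (hφ : φ.ring = stalkSubalgebra j p) {η : RationalForms E X l m} (hη : φ.IsRegularAt η) :
    η ∈ Set.range (formsMap E (stalkSubalgebra j p) X.functionField l m) := by
  obtain ⟨b, b', h⟩ := exists_basis_kaehlerDifferential_stalkSubalgebra j hK p hreg
  generalize stalkSubalgebra j p = A at hφ b h ⊢
  subst hφ
  exact mem_range_of_isRegularForm b b' h hη

lemma isRegularAt_of_stalkSubalgebra_le
    {m : ℕ} {y : Y} {φ : FormalPrimeDivisor E X l}
    (hφ : stalkSubalgebra j y ≤ φ.ring) {η : RationalForms E X l m}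
    (hη : η ∈ Set.range (formsMap E (stalkSubalgebra j y) X.functionField l m)) :
    φ.IsRegularAt η := by
  let := (Subalgebra.inclusion hφ).toAlgebra
  have : IsScalarTower (stalkSubalgebra j y) φ.ring X.functionField := .of_algebraMap_eq fun _ => rfl
  have : IsScalarTower E (stalkSubalgebra j y) φ.ring := .of_algebraMap_eq fun _ => rfl
  exact isRegularForm_of_mem_range (range_formsMap_mono φ.ring l m hη)

end Regular

/-! ### Morphisms from spectra of local rings -/

section LocalRings

lemma SpecMap_algebraMap_fromSpecStalk (X : Scheme.{u}) [IrreducibleSpace X] (x : X) :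
    Spec.map (CommRingCat.ofHom (algebraMap (X.presheaf.stalk x) X.functionField)) ≫
      X.fromSpecStalk x = X.fromSpecStalk (genericPoint X) :=
  Scheme.SpecMap_stalkSpecializes_fromSpecStalk ((genericPoint_spec X).specializes trivial)

lemma SpecMap_fromSpecStalk_closedPoint {X : Scheme.{u}} {x : X} {R : CommRingCat.{u}}
    [IsLocalRing R] (f : X.presheaf.stalk x ⟶ R) [IsLocalHom f.hom] :
    (Spec.map f ≫ X.fromSpecStalk x) (IsLocalRing.closedPoint R) = x :=
  (congrArg (X.fromSpecStalk x) (Spec_closedPoint (f := f))).trans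
    Scheme.fromSpecStalk_closedPoint

/-- Two maps from the function field to `Q` agree if they give the same morphism on `Spec Q`. -/
lemma functionField_ringHom_ext {X : Scheme.{u}} [IrreducibleSpace X] {Q : Type u} [CommRing Q]
    {f g : X.functionField →+* Q}
    (h : Spec.map (CommRingCat.ofHom f) ≫ X.fromSpecStalk (genericPoint X) =
      Spec.map (CommRingCat.ofHom g) ≫ X.fromSpecStalk (genericPoint X)) : f = g := by
  rw [cancel_mono] at h
  exact congr(($(Spec.map_injective h)).hom)

/-- If a morphism from the spectrum of a local ring `R` to `X` is given on `Spec Q → Spec R` by a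
map from the function field of `X`, then this map is compatible with the local map to `R` from
the local ring at the image of the closed point. -/
lemma stalkClosedPointTo_compatible {X : Scheme.{u}} [IrreducibleSpace X] {R Q : Type u}
    [CommRing R] [IsLocalRing R] [CommRing Q] (ι : R →+* Q) (κ : X.functionField →+* Q)
    (f : Spec (.of R) ⟶ X)
    (h : Spec.map (CommRingCat.ofHom ι) ≫ f =
      Spec.map (CommRingCat.ofHom κ) ≫ X.fromSpecStalk (genericPoint X))
    (a : X.presheaf.stalk (f (IsLocalRing.closedPoint R))) :
    κ (algebraMap _ X.functionField a) = ι (Scheme.stalkClosedPointTo f a) := by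
  rw [← Scheme.Spec_stalkClosedPointTo_fromSpecStalk f,
    ← SpecMap_algebraMap_fromSpecStalk X (f (IsLocalRing.closedPoint R)), ← Spec.map_comp_assoc,
    ← Spec.map_comp_assoc, cancel_mono] at h
  exact congr($(Spec.map_injective h) a).symm

end LocalRings

variable {E : Type u} [Field E] {X Y : Scheme.{u}} [IsIntegral X] [IsIntegral Y]
  [X.Over (Spec (.of E))] [Y.Over (Spec (.of E))] {l : ℕ}

/-- The identification `j` of function fields is the one given by `π`. -/
def IsFunctionFieldPullback (π : Y ⟶ X) (j : X.functionField ≃ₐ[E] Y.functionField) : Prop :=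
  Spec.map (CommRingCat.ofHom (j : X.functionField →+* Y.functionField)) ≫
    X.fromSpecStalk (genericPoint X) = Y.fromSpecStalk (genericPoint Y) ≫ π

variable {π : Y ⟶ X} {j : X.functionField ≃ₐ[E] Y.functionField}

/-! ### Centers of formal prime divisors and lifting to `Y` -/

namespace FormalPrimeDivisor

/-- The valuation ring `A` dominates the local ring at the center: `Spec Â ⟶ X` gives a local map
`O_{X,x} → Â`, whose image lies in `E(X) ∩ Â = A`. It stays local as a map to `A`, because units of
`A` are units of `Â`. -/
lemma exists_isLocalHom_stalk_center (φ : FormalPrimeDivisor E X l) :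
    ∃ h : X.presheaf.stalk φ.center →+* φ.ring, IsLocalHom h ∧
      ∀ a, algebraMap φ.ring X.functionField (h a) = algebraMap _ X.functionField a := by
  let g : X.presheaf.stalk φ.center →+* Completion φ.ring :=
    (Scheme.stalkClosedPointTo φ.hom).hom
  have hg : IsLocalHom g := Scheme.isLocalHom_stalkClosedPointTo φ.hom
  have key (a : X.presheaf.stalk φ.center) := stalkClosedPointTo_compatible _ _ φ.hom φ.generic a
  have hmem (a : X.presheaf.stalk φ.center) : algebraMap _ X.functionField a ∈ φ.ring := by
    obtain ⟨c, hc⟩ := mem_range_algebraMap_of_mem_completion (A := φ.ring) ⟨_, (key a).symm⟩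
    exact hc ▸ c.2
  let h : X.presheaf.stalk φ.center →+* φ.ring := (algebraMap _ X.functionField).codRestrict _ hmem
  refine ⟨h, ⟨fun a ha => hg.map_nonunit a ?_⟩, fun a => rfl⟩
  have : g a = algebraMap φ.ring (Completion φ.ring) (h a) := by
    apply IsFractionRing.injective (Completion φ.ring) (CompletionFrac φ.ring)
    rw [← IsScalarTower.algebraMap_apply, ← fracToCompletionFrac_algebraMap φ.ring X.functionField]
    exact (key a).symm
  rw [this]
  exact ha.map _

/-- Otherwise `A` would contain all of `E(X)` and be a field. -/
lemma center_ne_genericPoint (φ : FormalPrimeDivisor E X l) : φ.center ≠ genericPoint X := by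
  intro hφ
  obtain ⟨h, -, hh⟩ := φ.exists_isLocalHom_stalk_center
  refine IsDiscreteValuationRing.not_isField φ.ring ?_
  rw [← IsFractionRing.surjective_iff_isField (K := X.functionField)]
  intro z
  have hb : Function.Bijective (algebraMap (X.presheaf.stalk φ.center) X.functionField) := by
    have : IsIso (X.presheaf.stalkSpecializes
        ((genericPoint_spec X).specializes (Set.mem_univ φ.center))) :=
      (X.presheaf.stalkCongr (.of_eq hφ)).isIso_hom
    exact ConcreteCategory.bijective_of_isIso _
  obtain ⟨a, rfl⟩ := hb.2 z
  exact ⟨h a, hh a⟩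

lemma _root_.FormalAdjoint.IsFunctionFieldPullback.SpecMap_symm (hj : IsFunctionFieldPullback π j) :
    Spec.map (CommRingCat.ofHom (j.symm : Y.functionField →+* X.functionField)) ≫
      Y.fromSpecStalk (genericPoint Y) ≫ π = X.fromSpecStalk (genericPoint X) := by
  rw [← (show _ = _ from hj), ← Spec.map_comp_assoc, ← CommRingCat.ofHom_comp]
  have : (j.symm : Y.functionField →+* X.functionField).comp
      (j : X.functionField →+* Y.functionField) = .id _ := RingHom.ext j.symm_apply_apply
  rw [this, CommRingCat.ofHom_id, Spec.map_id, Category.id_comp]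

/-- A formal prime divisor lifts along proper birational morphisms. -/
lemma exists_stalkSubalgebra_le (hj : IsFunctionFieldPullback π j) [IsProper π]
    (φ : FormalPrimeDivisor E X l) :
    ∃ y : Y, π y = φ.center ∧ stalkSubalgebra j y ≤ φ.ring := by
  obtain ⟨h, hloc, hh⟩ := φ.exists_isLocalHom_stalk_center
  have hval : ValuativeCriterion π :=
    (IsProper.eq_valuativeCriterion.le _ _ π (inferInstanceAs (IsProper π))).1.1.1
  have hcomm : algebraMap (X.presheaf.stalk φ.center) X.functionField =
      (algebraMap φ.ring X.functionField).comp h := RingHom.ext fun a => (hh a).symm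
  -- The valuative criterion is applied to `A` itself, not to its completion; the lift sends the
  -- closed point to `y`.
  have sq : CommSq
      (Spec.map (CommRingCat.ofHom (j.symm : Y.functionField →+* X.functionField)) ≫
        Y.fromSpecStalk (genericPoint Y))
      (Spec.map (CommRingCat.ofHom (algebraMap φ.ring X.functionField))) π
      (Spec.map (CommRingCat.ofHom h) ≫ X.fromSpecStalk φ.center) := by
    constructor
    rw [Category.assoc, hj.SpecMap_symm,
      ← SpecMap_algebraMap_fromSpecStalk X φ.center, ← Spec.map_comp_assoc, ← CommRingCat.ofHom_comp,
      ← hcomm]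
  obtain ⟨L, hL1, hL2⟩ : ∃ L : Spec (.of φ.ring) ⟶ Y, _ = _ ∧ L ≫ π = _ :=
    (fun ⟨⟨L, h1, h2⟩⟩ => ⟨L, h1, h2⟩) (hval.existence ⟨φ.ring, X.functionField, _, _, sq⟩).exists_lift
  refine ⟨L (IsLocalRing.closedPoint φ.ring), ?_, ?_⟩
  · have : IsLocalHom (CommRingCat.ofHom h).hom := hloc
    exact congr($hL2 (IsLocalRing.closedPoint φ.ring)).trans
      (SpecMap_fromSpecStalk_closedPoint (R := .of φ.ring) _)
  · rintro _ ⟨a, rfl⟩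
    have := stalkClosedPointTo_compatible (algebraMap φ.ring X.functionField)
      (j.symm : Y.functionField →+* X.functionField) L hL1 a
    exact this ▸ Subtype.property _

end FormalPrimeDivisor
-- Formal prime divisors given by codimension-one points of `Y`
variable {E : Type u} [Field E] {X Y : Scheme.{u}} [IsIntegral X] [IsIntegral Y]
  [X.Over (Spec (.of E))] [Y.Over (Spec (.of E))] {l : ℕ}

/-- The morphism from the completed local ring at `p`. -/
noncomputable abbrev fromSpecCompletedStalk (Y : Scheme.{u}) (p : Y)
    [IsNoetherianRing (Y.presheaf.stalk p)] : Spec (.of (Completion (Y.presheaf.stalk p))) ⟶ Y :=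
  Spec.map (CommRingCat.ofHom
    (algebraMap (Y.presheaf.stalk p) (Completion (Y.presheaf.stalk p)))) ≫ Y.fromSpecStalk p

lemma SpecMap_algebraMap_fromSpecCompletedStalk (p : Y) [IsNoetherianRing (Y.presheaf.stalk p)] :
    Spec.map (CommRingCat.ofHom (algebraMap (Completion (Y.presheaf.stalk p))
      (CompletionFrac (Y.presheaf.stalk p)))) ≫ fromSpecCompletedStalk Y p =
    Spec.map (CommRingCat.ofHom (fracToCompletionFrac (Y.presheaf.stalk p) Y.functionField)) ≫
      Y.fromSpecStalk (genericPoint Y) := by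
  rw [← SpecMap_algebraMap_fromSpecStalk Y p, ← Spec.map_comp_assoc, ← Spec.map_comp_assoc,
    ← CommRingCat.ofHom_comp, ← CommRingCat.ofHom_comp]
  congr 3
  ext a
  exact (fracToCompletionFrac_algebraMap (Y.presheaf.stalk p) Y.functionField a).symm

namespace FormalPrimeDivisor

variable {π : Y ⟶ X} {j : X.functionField ≃ₐ[E] Y.functionField}

/-- A formal prime divisor on `X` that is represented by the completed local ring at a point of
`Y` has this local ring as its valuation ring. -/
lemma ring_eq_stalkSubalgebra (hj : IsFunctionFieldPullback π j) {p : Y}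
    [IsNoetherianRing (Y.presheaf.stalk p)] (φ : FormalPrimeDivisor E X l)
    (e : Spec (.of (Completion (Y.presheaf.stalk p))) ≅ Spec (.of (Completion φ.ring)))
    (he : e.hom ≫ φ.hom = fromSpecCompletedStalk Y p ≫ π) :
    φ.ring = stalkSubalgebra j p ∧ φ.center = π p := by
  obtain ⟨ε', hε'⟩ := Spec.map_surjective e.hom
  have : IsIso (Spec.map ε') := hε' ▸ inferInstance
  have : IsIso (Scheme.Spec.map ε'.op) := this
  have : IsIso ε'.op := isIso_of_reflects_iso ε'.op Scheme.Spec
  have : IsIso ε' := isIso_of_op ε'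
  let ε : Completion φ.ring ≃+* Completion (Y.presheaf.stalk p) :=
    (asIso ε').commRingCatIsoToRingEquiv
  let δ : CompletionFrac φ.ring ≃+* CompletionFrac (Y.presheaf.stalk p) :=
    IsFractionRing.ringEquivOfRingEquiv ε
  have hδ (c) : δ (algebraMap _ _ c) = algebraMap _ _ (ε c) :=
    IsFractionRing.ringEquivOfRingEquiv_algebraMap ε c
  have hε : e.hom = Spec.map (CommRingCat.ofHom (ε : Completion φ.ring →+* _)) := hε'.symm
  have hδε : (CommRingCat.ofHom (algebraMap (Completion φ.ring) (CompletionFrac φ.ring))) ≫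
      CommRingCat.ofHom (δ : _ →+* CompletionFrac (Y.presheaf.stalk p)) =
      CommRingCat.ofHom (ε : Completion φ.ring →+* _) ≫
      CommRingCat.ofHom (algebraMap (Completion (Y.presheaf.stalk p)) (CompletionFrac _)) := by
    ext c
    exact hδ c
  -- On function fields the isomorphism of completions induces `j`, since both sides give the same
  -- morphism from `Spec Q(Ô_{Y,p})` to `X`. Intersecting with the completions then identifies the
  -- two rings.
  have key : (δ : CompletionFrac φ.ring →+* _).comp (fracToCompletionFrac φ.ring X.functionField) =
      (fracToCompletionFrac (Y.presheaf.stalk p) Y.functionField).comp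
        (j : X.functionField →+* Y.functionField) := by
    apply functionField_ringHom_ext
    rw [CommRingCat.ofHom_comp, CommRingCat.ofHom_comp, Spec.map_comp_assoc, Spec.map_comp_assoc,
      ← φ.generic, show _ = _ from hj, ← Spec.map_comp_assoc, hδε, Spec.map_comp_assoc, ← hε, he,
      ← Category.assoc, SpecMap_algebraMap_fromSpecCompletedStalk, Category.assoc]
  replace key (f) : δ (fracToCompletionFrac φ.ring X.functionField f) =
      fracToCompletionFrac (Y.presheaf.stalk p) Y.functionField (j f) := congr($key f)
  constructor
  · ext f
    rw [mem_stalkSubalgebra_iff]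
    constructor
    · intro hf
      apply mem_range_algebraMap_of_mem_completion
      refine ⟨ε (algebraMap φ.ring _ ⟨f, hf⟩), ?_⟩
      rw [← key, ← hδ, ← IsScalarTower.algebraMap_apply,
        ← fracToCompletionFrac_algebraMap φ.ring X.functionField]
      rfl
    · rintro ⟨a, ha⟩
      obtain ⟨c, rfl⟩ := mem_range_algebraMap_of_mem_completion (A := φ.ring) (f := f)
        ⟨ε.symm (algebraMap _ _ a), δ.injective (by
          rw [hδ, key, ← ha, ε.apply_symm_apply, ← IsScalarTower.algebraMap_apply,
            fracToCompletionFrac_algebraMap])⟩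
      exact c.2
  · have h1 : e.hom (IsLocalRing.closedPoint (Completion (Y.presheaf.stalk p))) =
        IsLocalRing.closedPoint (Completion φ.ring) := by
      rw [hε]
      exact IsLocalRing.comap_closedPoint (ε : Completion φ.ring →+* Completion (Y.presheaf.stalk p))
    have h2 : (e.hom ≫ φ.hom) (IsLocalRing.closedPoint (Completion (Y.presheaf.stalk p))) =
      φ.center := congrArg φ.hom h1
    have : IsLocalHom (algebraMap (Y.presheaf.stalk p) (Completion (Y.presheaf.stalk p))) :=
      inferInstance
    have : IsLocalHom (CommRingCat.ofHom (algebraMap (Y.presheaf.stalk p)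
      (Completion (Y.presheaf.stalk p)))).hom := this
    rw [← h2, he]
    exact congrArg π
      (SpecMap_fromSpecStalk_closedPoint (R := .of (Completion (Y.presheaf.stalk p))) _)

/-- A regular point of codimension one on `Y` gives a formal prime divisor on `X`. -/
lemma exists_of_coheight_eq_one [CharZero E] [LocallyOfFiniteType (Y ↘ Spec (.of E))]
    (hj : IsFunctionFieldPullback π j) (hK : Algebra.trdeg E X.functionField = l) {p : Y}
    (hreg : IsRegularLocalRing (Y.presheaf.stalk p)) (hp : Order.coheight p = 1) :
    ∃ φ : FormalPrimeDivisor E X l, φ.ring = stalkSubalgebra j p ∧ φ.center = π p := by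
  have hregA := isRegularLocalRing_stalkSubalgebra j hreg
  have hdim : ringKrullDim (stalkSubalgebra j p) = 1 := by
    rw [← ringKrullDim_eq_of_ringEquiv (stalkEquiv j p).toRingEquiv, ringKrullDim_stalk_eq_coheight,
      hp]
    rfl
  -- Regular of dimension one: the cotangent space has dimension one.
  have hdvr : IsDiscreteValuationRing (stalkSubalgebra j p) := by
    rw [← IsLocalRing.finrank_CotangentSpace_eq_one_iff]
    have := (IsRegularLocalRing.iff_finrank_cotangentSpace _).mp hregA
    rw [hdim] at this
    exact_mod_cast this
  obtain ⟨f, hf, hloc⟩ : ∃ f : Y.presheaf.stalk p →+* Completion (stalkSubalgebra j p),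
      (∀ a, f a = algebraMap (stalkSubalgebra j p) _ (stalkEquiv j p a)) ∧ IsLocalHom f := by
    have : IsLocalHom (stalkEquiv j p : Y.presheaf.stalk p →+* stalkSubalgebra j p) := inferInstance
    exact ⟨(algebraMap (stalkSubalgebra j p) _).comp
      (stalkEquiv j p : Y.presheaf.stalk p →+* stalkSubalgebra j p), fun _ => rfl,
      RingHom.isLocalHom_comp _ _⟩
  have : IsLocalHom (CommRingCat.ofHom f).hom := hloc
  have hc := congrArg π (SpecMap_fromSpecStalk_closedPoint
    (R := .of (Completion (stalkSubalgebra j p))) (CommRingCat.ofHom f))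
  refine ⟨{
    ring := stalkSubalgebra j p
    isDVR := hdvr
    isFractionRing := inferInstance
    trdeg_residueField := trdeg_residueField_add_one X.functionField hK hdim
    hom := (Spec.map (CommRingCat.ofHom f) ≫ Y.fromSpecStalk p) ≫ π
    generic := ?_ }, rfl, hc⟩
  rw [← hj.SpecMap_symm, ← SpecMap_algebraMap_fromSpecStalk Y p]
  simp only [Category.assoc, ← Spec.map_comp_assoc, ← CommRingCat.ofHom_comp]
  congr 3
  ext a
  refine (congrArg (algebraMap (Completion (stalkSubalgebra j p)) (CompletionFrac (stalkSubalgebra j p)))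
    (hf a)).trans
    ?_
  exact (fracToCompletionFrac_algebraMap (stalkSubalgebra j p) X.functionField
    (stalkEquiv j p a)).symm

end FormalPrimeDivisor

/-! ### Codimension-one points in closures -/

section CodimensionOne

variable {Y : Scheme.{u}} [IsIntegral Y]

/-- A point of codimension one has no proper generization other than the generic point. -/
lemma eq_of_specializes_of_coheight_eq_one {t z : Y} (h : t ⤳ z) (hz : Order.coheight z = 1)
    (ht : t ≠ genericPoint Y) : t = z := by
  by_contra hne
  have hg : genericPoint Y ⤳ t := (genericPoint_spec Y).specializes trivial
  have h1 : z < t := lt_of_le_not_ge (Scheme.le_iff_specializes.mpr h)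
    fun h' => hne (h.antisymm h').eq
  have h2 : t < genericPoint Y := lt_of_le_not_ge (Scheme.le_iff_specializes.mpr hg)
    fun h' => ht (Specializes.antisymm h' hg).eq
  have h3 := Order.coheight_add_one_le h1
  have h4 := Order.coheight_add_one_le h2
  rw [hz] at h3
  have h5 : (1 : ℕ∞) + 1 ≤ 1 := by
    refine le_trans ?_ h3
    gcongr
    exact le_trans le_add_self h4
  exact absurd h5 (by decide)

/-- On a Noetherian integral scheme, the points of codimension one in the closure of a set of
such points, if this closure is not everything, belong to the set. -/
lemma mem_of_mem_closure_of_coheight_eq_one [TopologicalSpace.NoetherianSpace Y] {Z : Set Y}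
    (hZ : ∀ z ∈ Z, Order.coheight z = 1) (hη : genericPoint Y ∉ closure Z) {p : Y}
    (hp : p ∈ closure Z) (hp1 : Order.coheight p = 1) : p ∈ Z := by
  obtain ⟨F, hF, hcl, hirr, hFZ⟩ :=
    TopologicalSpace.NoetherianSpace.exists_finite_set_isClosed_irreducible (isClosed_closure (s := Z))
  -- Each point of `Z` is the generic point of one of the finitely many irreducible closed sets that
  -- make up the closure. So the closure is the union of the closures of single points.
  have hfin : Z.Finite := by
    have : Finite F := hF
    refine (Set.finite_range fun t : F => (hirr t t.2).genericPoint).subset fun z hz => ?_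
    obtain ⟨t, ht, hzt⟩ : z ∈ ⋃₀ F := hFZ ▸ subset_closure hz
    have hspec : IsGenericPoint (hirr t ht).genericPoint t :=
      (hirr t ht).isGenericPoint_genericPoint_closure.trans (hcl t ht).closure_eq
    refine ⟨⟨t, ht⟩, eq_of_specializes_of_coheight_eq_one (hspec.specializes hzt) (hZ z hz) ?_⟩
    intro h
    exact hη (hFZ ▸ ⟨t, ht, h ▸ hspec.mem⟩)
  rw [← Set.biUnion_of_singleton Z, hfin.closure_biUnion, Set.mem_iUnion₂] at hp
  obtain ⟨z, hz, hzp⟩ := hp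
  rwa [← eq_of_specializes_of_coheight_eq_one (specializes_iff_mem_closure.mpr hzp) hp1]
  rintro rfl
  exact hη (subset_closure hz)

end CodimensionOne

/-! ### Formal descriptions and the hard direction -/

section Description

variable {E : Type u} [Field E] {X Y : Scheme.{u}} [IsIntegral X] [IsIntegral Y]
  [X.Over (Spec (.of E))] [Y.Over (Spec (.of E))] {l : ℕ} {π : Y ⟶ X}
  {S : Set (FormalPrimeDivisor E X l)}

/-- The support is a finite union of closures of non-generic points. This is what keeps `supp (π^*
S)` from being all of `Y`. -/
lemma genericPoint_notMem_supp (hS : S.Finite) : genericPoint X ∉ supp S := by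
  intro h
  rw [supp, ← Set.biUnion_of_singleton (FormalPrimeDivisor.center '' S),
    (hS.image _).closure_biUnion, Set.mem_iUnion₂] at h
  obtain ⟨_, ⟨φ, -, rfl⟩, h⟩ := h
  exact φ.center_ne_genericPoint ((specializes_iff_mem_closure.mpr h).antisymm
    ((genericPoint_spec X).specializes trivial)).eq

/-- With this, `ring_eq_stalkSubalgebra` also applies to divisors on `Y` itself. -/
lemma isFunctionFieldPullback_id :
    IsFunctionFieldPullback (𝟙 Y) (AlgEquiv.refl : Y.functionField ≃ₐ[E] Y.functionField) := by
  rw [IsFunctionFieldPullback, Category.comp_id]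
  exact (congrArg (· ≫ _) (Spec.map_id _)).trans (Category.id_comp _)

/-- The centers of the pullback of `S` are points of codimension one whose local rings are the
valuation rings of elements of `S`. -/
lemma IsFormalDescription.exists_ring_eq (hπ : IsFormalDescription π S)
    {j : X.functionField ≃ₐ[E] Y.functionField} (hj : IsFunctionFieldPullback π j)
    {ψ : FormalPrimeDivisor E Y l} (hψ : ψ ∈ pullbackSet π S) :
    Order.coheight ψ.center = 1 ∧
      ∃ φ ∈ S, φ.ring = stalkSubalgebra j ψ.center ∧ φ.center = π ψ.center := by
  obtain ⟨p, hreg, hp, e, he⟩ := hπ.realized ψ hψ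
  obtain ⟨φ, hφ, e', he'⟩ := hψ
  have hc : ψ.center = p := (ψ.ring_eq_stalkSubalgebra isFunctionFieldPullback_id e
    (he.trans (Category.comp_id _).symm)).2
  rw [hc]
  -- Composing the realization of `ψ` on `Y` with the isomorphism that makes `ψ` a lift of `φ`
  -- represents `φ` by the completed local ring at `p`.
  refine ⟨hp, φ, hφ, φ.ring_eq_stalkSubalgebra hj (e ≪≫ e') ?_⟩
  rw [Iso.trans_hom, Category.assoc, he', ← Category.assoc, he]

/-- The preimage of `supp S` is the closure of the centers of `π^* S`. A codimension-one point in it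
must be one of these centers. -/
lemma IsFormalDescription.exists_of_mem_supp [TopologicalSpace.NoetherianSpace Y]
    (hπ : IsFormalDescription π S) (hbir : IsBirational π)
    {j : X.functionField ≃ₐ[E] Y.functionField} (hj : IsFunctionFieldPullback π j)
    {p : Y} (hp : Order.coheight p = 1) (hpS : π p ∈ supp S) :
    ∃ φ ∈ S, φ.ring = stalkSubalgebra j p ∧ φ.center = π p := by
  have hmem : p ∈ FormalPrimeDivisor.center '' pullbackSet π S := by
    refine mem_of_mem_closure_of_coheight_eq_one ?_ ?_ (hπ.preimage_supp.le hpS) hp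
    · rintro _ ⟨ψ, hψ, rfl⟩
      exact (hπ.exists_ring_eq hj hψ).1
    · intro h
      have : π (genericPoint Y) ∈ supp S := hπ.preimage_supp.ge h
      rw [hbir.map_genericPoint] at this
      exact genericPoint_notMem_supp hπ.finite this
  obtain ⟨ψ, hψ, rfl⟩ := hmem
  exact (hπ.exists_ring_eq hj hψ).2

/-- A form is adjoint if it is so off the support of a formal desingularization and regular at
the elements of the latter. -/
lemma mem_adjointForms_of_isFormalDesingularization [CharZero E]
    [LocallyOfFiniteType (X ↘ Spec (.of E))] [QuasiCompact (X ↘ Spec (.of E))] {m : ℕ}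
    (hl : topologicalKrullDim X = l) (hS : IsFormalDesingularization S) {U : X.Opens}
    {η : RationalForms E X l m} (h1 : η ∈ adjointForms l m (U ⊓ suppCompl S))
    (h2 : ∀ φ ∈ S, φ.center ∈ U → φ.IsRegularAt η) : η ∈ adjointForms l m U := by
  obtain ⟨Y, _, _, π, _, hdes, hdesc⟩ := hS
  have := hdes.proper
  have hcomp : π ≫ X ↘ Spec (.of E) = Y ↘ Spec (.of E) := comp_over π (Spec (.of E))
  have : LocallyOfFiniteType (Y ↘ Spec (.of E)) := hcomp ▸ inferInstance
  have : QuasiCompact (Y ↘ Spec (.of E)) := hcomp ▸ inferInstance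
  have : IsLocallyNoetherian Y := LocallyOfFiniteType.isLocallyNoetherian (Y ↘ Spec (.of E))
  have : CompactSpace Y := QuasiCompact.compactSpace_of_compactSpace (Y ↘ Spec (.of E))
  have : IsNoetherian Y := {}
  have hK := trdeg_functionField_eq E hl
  obtain ⟨j, hj⟩ := hdes.birational.exists_algEquiv (E := E)
  replace hj : IsFunctionFieldPullback π j := hj
  intro φ hφ
  obtain ⟨y, hy, hle⟩ := φ.exists_stalkSubalgebra_le hj
  refine isRegularAt_of_stalkSubalgebra_le j hle
    (mem_range_formsMap_of_coheight_one j hK hdes.regular fun p hpy hp => ?_)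
  -- Open sets are stable under generization, and `π p` specializes to the center of `φ`.
  have hpU : π p ∈ U := (hpy.map π.continuous).mem_open U.2 (hy ▸ hφ)
  -- Over the support `p` yields an element of `S`; elsewhere it yields a formal prime divisor
  -- centered in `U \ supp S`.
  by_cases hpS : π p ∈ supp S
  · obtain ⟨φ', hφ', hring, hc⟩ := hdesc.exists_of_mem_supp hdes.birational hj hp hpS
    exact mem_range_formsMap_of_isRegularAt j hK (hdes.regular p) hring (h2 φ' hφ' (hc ▸ hpU))
  · obtain ⟨φ', hring, hc⟩ :=
      FormalPrimeDivisor.exists_of_coheight_eq_one hj hK (hdes.regular p) hp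
    refine mem_range_formsMap_of_isRegularAt j hK (hdes.regular p) hring (h1 φ' ?_)
    rw [hc]
    exact ⟨hpU, hpS⟩

end Description

end FormalAdjoint

theorem mainTheorem4 {E : Type u} [Field E] [CharZero E]
    (X : Scheme.{u}) [X.Over (Spec (.of E))] [IsIntegral X]
    [IsSeparated (X ↘ Spec (.of E))] [LocallyOfFiniteType (X ↘ Spec (.of E))]
    [QuasiCompact (X ↘ Spec (.of E))]
    (l m : ℕ) (hl : topologicalKrullDim X = l)
    (S : Set (FormalPrimeDivisor E X l)) (hS : IsFormalDesingularization S)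
    (U : X.Opens) (η : RationalForms E X l m) :
    η ∈ adjointForms l m U ↔
      η ∈ adjointForms l m (U ⊓ suppCompl S) ∧ ∀ φ ∈ S, φ.center ∈ U → φ.IsRegularAt η := by
  refine ⟨fun h => ⟨fun φ hφ => h φ hφ.1, fun φ _ hφ => h φ hφ⟩, fun h => ?_⟩
  exact mem_adjointForms_of_isFormalDesingularization hl hS h.1 h.2
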